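/- Let $\mathfrak f$ be a finite-dimensional semisimple complex Lie algebra with Killing form $\kappa$, Cartan subalgebra $\mathfrak h$, simple roots $\alpha_1,\dots,\alpha_l$, and root vectors $E_\alpha$ with $\kappa(E_\alpha,E_{-\alpha})=1$. For $\lambda\in\mathfrak h^*$ let $\zeta(\lambda)\in\mathfrak h$ be defined by $\kappa(\zeta(\lambda),X)=\lambda(X)$ for $X\in\mathfrak h$. Put $H_i=\zeta(\alpha_i)$, $d_i=\tfrac12\kappa(H_i,H_i)$, $\alpha_i^\vee=d_i^{-1}H_i$, $A_{ij}=\alpha_j(\alpha_i^\vee)$ and $P_i=\zeta(\omega_i)$, where $(\omega_i)$ is the basis of $\mathfrak h^*$ dual to $(\alpha_i^\vee)$. Let $\beta_1,\dots,\beta_N$ be an ordering of the positive roots such that if $i<j$ and $\beta_i+\beta_j$ is a root, then $\beta_i+\beta_j=\beta_k$ for some $i<k<j$. Let $c=1$ (split case) or $c=i$ (non-split case), let $\gamma\in\mathbb R\setminus\{0\}$, $q=e^{-ic\gamma}$ and $q^z:=e^{-ic\gamma z}$. Let $R=c(\pi_{\mathfrak n_+}-\pi_{\mathfrak n_-})$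 be the standard $R$-matrix, where $\pi_{\mathfrak n_\pm}$ are the projections of $\mathfrak f=\mathfrak h\oplus\mathfrak n_+\oplus\mathfrak n_-$, let $R^\pm=R\pm c\,\mathrm{Id}$, and let $R_{12},R^\pm_{12}\in\mathfrak f\otimes\mathfrak f$ be their kernels with respect to $\kappa$ (the kernel $\sum a\otimes b$ of $T$ satisfies $TX=\sum\kappa(b,X)\,a$ for all $X$). Let $M$ be a Poisson manifold, with its Poisson bracket extended $\mathbb C$-bilinearly to complex-valued smooth functions. Let $A_\beta\in\mathbb C\setminus\{0\}$ be constants, and let $Q^H_i$ ($1\le i\le l$) and $Q^E_\beta$ ($\beta$ a root) be complex-valued smooth functions on $M$. In a fixed faithful finite-dimensional representation of $\mathfrak f$, let $\Gamma^+=M^+D$ and $\Gamma^-=D^{-1}M^-$ with $$D=\exp\Bigl(ic\gamma\sum_{i=1}^l Q^H_iP_i\Bigr),\qquad M^\pm=\prod_{k=1}^N\exp\bigl(\pm ic\gamma A_{\pm\beta_k}Q^E_{\pm\beta_k}E_{\pm\beta_k}\bigr),$$ the products being taken in the order $k=1,\dots,N$. Assume the Semenov-Tian-Shansky brackets $$\{\Gamma^\pm_1,\Gamma^\pm_2\}=\gamma[R_{12},\Gamma^\pm_1\Gamma^\pm_2],\qquad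 \{\Gamma^\pm_1,\Gamma^\mp_2\}=\gamma[R^\pm_{12},\Gamma^\pm_1\Gamma^\mp_2].$$ Then, for all $i,j$, $$\{Q^H_i,Q^H_j\}=0,\qquad i\{Q^H_i,Q^E_{\pm\alpha_j}\}=\pm A_{ij}\,Q^E_{\pm\alpha_j}.$$ If, moreover, for every $i$, $A_{\alpha_i}=A_{-\alpha_i}$ is a square root of $\dfrac{4\sinh(ic\gamma d_i)}{ic\gamma}$ (nonzero by assumption, so that $q^{d_i}\neq q^{-d_i}$), then for all $i,j$ $$i\{Q^E_{\alpha_i},Q^E_{-\alpha_j}\}=\delta_{ij}\,\frac{q^{d_iQ^H_i}-q^{-d_iQ^H_i}}{q^{d_i}-q^{-d_i}}.$$ -/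

import Mathlib

open scoped Manifold ContDiff TensorProduct Kronecker

attribute [local instance 100] LieRing.ofAssociativeRing

noncomputable section

/-! ### Poisson manifolds -/

section Poisson

variable {E : Type*} [NormedAddCommGroup E] [NormedSpace ℝ E]
  {X : Type*} [TopologicalSpace X] (I : ModelWithCorners ℝ E X)
  (M : Type*) [TopologicalSpace M] [ChartedSpace X M]

/-- A Poisson bracket on the algebra of real-valued smooth functions of a manifold `M`. -/
structure PoissonStructure where
  bracket : C^∞⟮I, M; ℝ⟯ →ₗ[ℝ] C^∞⟮I, M; ℝ⟯ →ₗ[ℝ] C^∞⟮I, M; ℝ⟯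
  skew : ∀ f g, bracket f g = -bracket g f
  leibniz : ∀ f g h, bracket f (g * h) = bracket f g * h + g * bracket f h
  jacobi : ∀ f g h, bracket f (bracket g h) + bracket g (bracket h f) + bracket h (bracket f g) = 0

/-- Complex-valued smooth functions on the (real) manifold `M`. -/
abbrev SmoothC := C^∞⟮I, M; 𝓘(ℝ, ℂ), ℂ⟯

variable {I M}

/-- Real part of a complex-valued smooth function. -/
def SmoothC.re (f : SmoothC I M) : C^∞⟮I, M; ℝ⟯ :=
  ⟨fun x => (f x).re, Complex.reCLM.contDiff.comp_contMDiff f.contMDiff⟩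

/-- Imaginary part of a complex-valued smooth function. -/
def SmoothC.im (f : SmoothC I M) : C^∞⟮I, M; ℝ⟯ :=
  ⟨fun x => (f x).im, Complex.imCLM.contDiff.comp_contMDiff f.contMDiff⟩

/-- The complex bilinear extension of the Poisson bracket to complex-valued smooth functions,
evaluated at a point: `{f, g}(x)`. -/
def PoissonStructure.pb (P : PoissonStructure I M) (f g : SmoothC I M) (x : M) : ℂ :=
  ((P.bracket f.re g.re x - P.bracket f.im g.im x : ℝ) : ℂ) +
    ((P.bracket f.re g.im x + P.bracket f.im g.re x : ℝ) : ℂ) * Complex.I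

variable {n : Type*}

/-- The value at a point of a matrix of smooth functions. -/
def matrixEval (A : Matrix n n (SmoothC I M)) (x : M) : Matrix n n ℂ :=
  A.map fun f => f x

/-- The tensorial bracket `{A₁, B₂}` of two matrix-valued functions, evaluated at a point: its
`((i, k), (j, l))` entry is `{A i j, B k l}`. -/
def PoissonStructure.tensorPB (P : PoissonStructure I M) (A B : Matrix n n (SmoothC I M))
    (x : M) : Matrix (n × n) (n × n) ℂ :=
  Matrix.of fun p q => P.pb (A p.1 q.1) (B p.2 q.2) x

end Poisson

/-! ### The standard `R`-matrix and its kernel -/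

section Lie

open LieAlgebra LieAlgebra.IsKilling

variable {L : Type*} [LieRing L] [LieAlgebra ℂ L] [FiniteDimensional ℂ L]

section Kernel

variable [IsKilling ℂ L]

/-- The isomorphism `L ⊗ L ≃ End L` given by the Killing form `κ`: the tensor `a ⊗ b`
corresponds to the operator `X ↦ κ(b, X) a`. -/
def killingContract : L ⊗[ℂ] L ≃ₗ[ℂ] (L →ₗ[ℂ] L) :=
  TensorProduct.comm ℂ L L ≪≫ₗ
    TensorProduct.congr
      ((killingForm ℂ L).toDual (IsKilling.killingForm_nondegenerate ℂ L))
      (LinearEquiv.refl ℂ L) ≪≫ₗ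
    dualTensorHomEquiv ℂ L L

lemma killingContract_tmul (a b Y : L) :
    killingContract (a ⊗ₜ[ℂ] b) Y = killingForm ℂ L b Y • a := by
  simp [killingContract, LinearMap.BilinForm.toDual_def]

/-- The kernel `T₁₂` of an operator `T` with respect to the Killing form. -/
def killingKernel (T : L →ₗ[ℂ] L) : L ⊗[ℂ] L := killingContract.symm T

end Kernel

variable (H : LieSubalgebra ℂ L) [H.IsCartanSubalgebra]

/-- The sum of the weight spaces `L_χ`, `χ ∈ S`, of the Cartan subalgebra `H`
(with `L_0 = H`). -/
def weightSum (S : Set (LieModule.Weight ℂ H L)) : Submodule ℂ L :=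
  ⨆ χ ∈ S, (LieModule.genWeightSpace L χ).toSubmodule

lemma isCompl_weightSum (S : Set (LieModule.Weight ℂ H L)) :
    IsCompl (weightSum H S) (weightSum H Sᶜ) := by
  have hind : iSupIndep fun χ : LieModule.Weight ℂ H L =>
      (LieModule.genWeightSpace L χ).toSubmodule :=
    LieSubmodule.iSupIndep_toSubmodule.mpr (LieModule.iSupIndep_genWeightSpace' ℂ H L)
  have htop : ⨆ χ : LieModule.Weight ℂ H L,
      (LieModule.genWeightSpace L χ).toSubmodule = ⊤ := by
    have := congrArg LieSubmodule.toSubmodule (LieModule.iSup_genWeightSpace_eq_top' ℂ H L)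
    simpa only [LieSubmodule.iSup_toSubmodule, LieSubmodule.top_toSubmodule] using this
  refine ⟨hind.disjoint_biSup_biSup disjoint_compl_right, codisjoint_iff.mpr ?_⟩
  rw [eq_top_iff, ← htop]
  refine iSup_le fun χ => ?_
  by_cases h : χ ∈ S
  · exact le_sup_of_le_left (le_biSup (fun χ : LieModule.Weight ℂ H L =>
      (LieModule.genWeightSpace L χ).toSubmodule) h)
  · exact le_sup_of_le_right (le_biSup (fun χ : LieModule.Weight ℂ H L =>
      (LieModule.genWeightSpace L χ).toSubmodule) (show χ ∈ Sᶜ from h))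

/-- The projection onto the sum of the weight spaces in `S` along the sum of all the others. -/
def weightProj (S : Set (LieModule.Weight ℂ H L)) : L →ₗ[ℂ] L :=
  (weightSum H S).projection (weightSum H Sᶜ) (isCompl_weightSum H S)

variable {H} [IsKilling ℂ L]

/-- The root `-α`. -/
def negRoot (α : H.root) : H.root :=
  ⟨-α.1, by
    have h := α.2
    simp only [LieSubalgebra.root, Finset.mem_filter, Finset.mem_univ, true_and] at h ⊢
    exact h.neg⟩

variable (b : (rootSystem H).Base)

/-- The positive roots, as weights of `H`. -/
def posWeights : Set (LieModule.Weight ℂ H L) := {χ | ∃ α : H.root, b.IsPos α ∧ χ = α.1}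

/-- The negative roots, as weights of `H`. -/
def negWeights : Set (LieModule.Weight ℂ H L) :=
  {χ | ∃ α : H.root, b.IsPos α ∧ χ = (negRoot α).1}

/-- The standard `R`-matrix `R = c (π_{𝔫₊} - π_{𝔫₋})`. -/
def standardR (c : ℂ) : L →ₗ[ℂ] L :=
  c • (weightProj H (posWeights b) - weightProj H (negWeights b))

/-! ### Data attached to the simple roots -/

/-- `H_α`, characterised by `κ(H_α, Y) = α(Y)` for `Y` in the Cartan subalgebra. -/
def rootVec (α : H.root) : H := (cartanEquivDual H).symm ((rootSystem H).root α)

/-- `d_i = (α_i, α_i) / 2 = κ(H_i, H_i) / 2`. -/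
def dSimple (i : b.support) : ℂ :=
  killingForm ℂ L (rootVec (i : H.root) : L) (rootVec (i : H.root) : L) / 2

/-- The Cartan matrix in the convention `A_ij = α_j(α_i^∨)`. -/
def cartanEntry (i j : b.support) : ℂ :=
  (rootSystem H).root (j : H.root) ((rootSystem H).coroot (i : H.root))

/-- `P_i`, the image in the Cartan subalgebra, under the Killing form, of the fundamental weight
`ω_i`, where `(ω_i)` is the dual basis of the simple coroots `(α_i^∨)`. -/
def fundP (i : b.support) : H := (cartanEquivDual H).symm (b.toCoweightBasis.coord i)

/-- `β₁, …, β_N` is a labelling of the positive roots such that, if `i < j` and `β_i + β_j` is a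
root, then `β_i + β_j = β_k` for some `i < k < j`. -/
structure IsConvexOrder {N : ℕ} (β : Fin N → H.root) : Prop where
  injective : Function.Injective β
  range_eq : Set.range β = {α | b.IsPos α}
  convex : ∀ i j : Fin N, i < j → ∀ δ : H.root,
    (rootSystem H).root δ = (rootSystem H).root (β i) + (rootSystem H).root (β j) →
      ∃ k : Fin N, i < k ∧ k < j ∧ β k = δ

/-- Root vectors normalised by `κ(E_α, E_{-α}) = 1`. -/
structure IsCartanWeyl (e : H.root → L) : Prop where
  mem : ∀ α : H.root, e α ∈ LieAlgebra.rootSpace H α.1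
  norm : ∀ α : H.root, killingForm ℂ L (e α) (e (negRoot α)) = 1

/-! ### Parametrisation by charges -/

section Matrices

variable {n : Type*} [Fintype n] [DecidableEq n] (ρ : L →ₗ⁅ℂ⁆ Matrix n n ℂ)

/-- `ρ ⊗ ρ`, with values in matrices through the Kronecker product. -/
def tensorRep : L ⊗[ℂ] L →ₗ[ℂ] Matrix (n × n) (n × n) ℂ :=
  TensorProduct.lift
    ((Matrix.kroneckerBilinear (R := ℂ) (α := ℂ)).compl₁₂ (ρ : L →ₗ[ℂ] Matrix n n ℂ)
      (ρ : L →ₗ[ℂ] Matrix n n ℂ))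

/-- `Z = i c γ ∑ Q^H_i P_i`, at given values of the charges. -/
def cartanZ (c : ℂ) (γ : ℝ) (QH : b.support → ℂ) : L :=
  (Complex.I * c * γ) • ∑ i, QH i • (fundP b i : L)

/-- `D = exp Z`. -/
def cartanD (c : ℂ) (γ : ℝ) (QH : b.support → ℂ) : Matrix n n ℂ :=
  NormedSpace.exp (ρ (cartanZ b c γ QH))

/-- The inverse `D⁻¹ = exp (-Z)`. -/
def cartanDInv (c : ℂ) (γ : ℝ) (QH : b.support → ℂ) : Matrix n n ℂ :=
  NormedSpace.exp (-ρ (cartanZ b c γ QH))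

variable (e : H.root → L) (A : H.root → ℂ)

/-- `M⁺`, the ordered product of the `exp (i c γ A_{β_k} Q^E_{β_k} E_{β_k})`, `k = 1, …, N`. -/
def unipotentPlus {N : ℕ} (β : Fin N → H.root) (c : ℂ) (γ : ℝ) (QE : H.root → ℂ) :
    Matrix n n ℂ :=
  (List.ofFn fun k : Fin N =>
    NormedSpace.exp ((Complex.I * c * γ * A (β k) * QE (β k)) • ρ (e (β k)))).prod

/-- `M⁻`, the ordered product of the `exp (-i c γ A_{-β_k} Q^E_{-β_k} E_{-β_k})`,
`k = 1, …, N`. -/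
def unipotentMinus {N : ℕ} (β : Fin N → H.root) (c : ℂ) (γ : ℝ) (QE : H.root → ℂ) :
    Matrix n n ℂ :=
  (List.ofFn fun k : Fin N =>
    NormedSpace.exp ((-(Complex.I * c * γ * A (negRoot (β k)) * QE (negRoot (β k)))) •
      ρ (e (negRoot (β k))))).prod

section STS

variable {E : Type*} [NormedAddCommGroup E] [NormedSpace ℝ E]
  {X : Type*} [TopologicalSpace X] {I : ModelWithCorners ℝ E X}
  {M : Type*} [TopologicalSpace M] [ChartedSpace X M]

/-- The quadratic bracket `{A₁, B₂} = γ [r₁₂, A₁ B₂]`. -/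
def QuadraticPB (P : PoissonStructure I M) (γ : ℝ) (r : L ⊗[ℂ] L)
    (A B : Matrix n n (SmoothC I M)) : Prop :=
  ∀ x : M, P.tensorPB A B x =
    (γ : ℂ) • (tensorRep ρ r * (matrixEval A x ⊗ₖ matrixEval B x) -
      (matrixEval A x ⊗ₖ matrixEval B x) * tensorRep ρ r)

/-- The Semenov-Tian-Shansky brackets
`{Γ^±₁, Γ^±₂} = γ [R₁₂, Γ^±₁ Γ^±₂]` and `{Γ^±₁, Γ^∓₂} = γ [R^±₁₂, Γ^±₁ Γ^∓₂]`,
with `R^± = R ± c Id`. -/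
structure STSBrackets (P : PoissonStructure I M) (γ : ℝ) (c : ℂ) (R : L →ₗ[ℂ] L)
    (Γp Γm : Matrix n n (SmoothC I M)) : Prop where
  pp : QuadraticPB ρ P γ (killingKernel R) Γp Γp
  mm : QuadraticPB ρ P γ (killingKernel R) Γm Γm
  pm : QuadraticPB ρ P γ (killingKernel (R + c • LinearMap.id)) Γp Γm
  mp : QuadraticPB ρ P γ (killingKernel (R - c • LinearMap.id)) Γm Γp

end STS

end Matrices

end Lie

/-- `q ^ z` for the deformation parameter `q = e^{-i c γ}`, that is `e^{-i c γ z}`. -/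
def qPow (c : ℂ) (γ : ℝ) (z : ℂ) : ℂ := Complex.exp (-(Complex.I * c * γ) * z)

end

noncomputable section

/-! ### Point derivations of complex-valued smooth functions -/

/-! Everything follows from the one mixed bracket `{Γ⁺₁, Γ⁻₂} = γ [R⁺₁₂, Γ⁺₁ Γ⁻₂]`. Put `Z = ε ∑
Q^H_i P_i` with `ε = i c γ`, and write `Γ⁺ = G`, `Γ⁻ = G'⁻¹`. Both `G` and `G'` are an ordered
product of exponentials of root vectors times `D = exp Z`: positive roots for `G`, negative roots
for `G'`.

Translate the first leg by `G⁻¹` and the second by `G'`, then pair with vectors `U`, `Y` through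
`κ`. If `κ(U, G⁻¹ δG) = t δp` and `κ(Y, G'⁻¹ δG') = t' δq` for every point derivation `δ`, the
bracket becomes `-t t' {p, q} = γ (κ(U, Ad_{G⁻¹} R⁺Y) - κ(Y, Ad_{G'⁻¹} (R⁺)*U))`, where `(R⁺)*` is
the Killing adjoint (`QuadraticPB.killing_contract`).

Grade by height. A vector `U` of height `-1` or `0` is orthogonal to heights at least `2`, so in
`G⁻¹ δG` and `Ad_{G⁻¹}` only terms of first order in the root vectors survive, and these do not
depend on the order of the factors (`IsLieFiltration.expProd_conj`,
`IsLieFiltration.exists_hasMatrixDeriv_expProd`). Conjugation by `D` only multiplies the pairing by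
a scalar exponential, as `U` is an eigenvector of `ad Z`. Hence `U = E_{-α}`, `α` simple, reads off
`Q^E_α`, and `U = α_i^∨` reads off `Q^H_i`; the same holds for `G'` with signs reversed.

Finally `R⁺` is `c` on `𝔥` and `2c` on `𝔫₊`, while `(R⁺)*` is `c` on `𝔥` and `2c` on `𝔫₋`. The four
choices of `(U, Y)` among simple coroots and simple root vectors give the four relations. -/

instance contMDiffRing_complex {n : ℕ∞ω} : ContMDiffRing 𝓘(ℝ, ℂ) n ℂ :=
  { instNormedSpaceLieAddGroup with
    contMDiff_mul := by
      rw [contMDiff_iff]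
      refine ⟨continuous_mul, fun x y => ?_⟩
      simp only [mfld_simps, chartAt_self_eq]
      rw [contDiffOn_univ]
      exact contDiff_mul }

section PointDerivation

variable {E : Type*} [NormedAddCommGroup E] [NormedSpace ℝ E]
  {X : Type*} [TopologicalSpace X] {I : ModelWithCorners ℝ E X}
  {M : Type*} [TopologicalSpace M] [ChartedSpace X M]

/-- The constant function. -/
def SmoothC.const (z : ℂ) : SmoothC I M := ⟨fun _ => z, contMDiff_const⟩

@[simp] lemma SmoothC.const_apply (z : ℂ) (x : M) : SmoothC.const (I := I) z x = z := rfl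

/-- A derivation at the point `x` of the algebra of complex-valued smooth functions. -/
structure IsPointDerivation (x : M) (δ : SmoothC I M →+ ℂ) : Prop where
  mul : ∀ f g, δ (f * g) = δ f * g x + f x * δ g
  const : ∀ z, δ (SmoothC.const z) = 0

lemma PoissonStructure.bracket_const (P : PoissonStructure I M) (f : C^∞⟮I, M; ℝ⟯) (r : ℝ)
    (g : C^∞⟮I, M; ℝ⟯) (hg : ∀ x, g x = r) : P.bracket f g = 0 := by
  have h1 : P.bracket f 1 = 0 := by
    have h := P.leibniz f 1 1
    simpa using h
  have : g = r • (1 : C^∞⟮I, M; ℝ⟯) := by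
    ext x
    simp [hg]
  rw [this, map_smul, h1, smul_zero]

/-- The bracket `{f, ·}(x)` as an additive map. -/
def PoissonStructure.pbRight (P : PoissonStructure I M) (f : SmoothC I M) (x : M) :
    SmoothC I M →+ ℂ :=
  AddMonoidHom.mk' (fun g => P.pb f g x) fun g h => by
    have h1 : (g + h).re = g.re + h.re := rfl
    have h2 : (g + h).im = g.im + h.im := rfl
    simp only [PoissonStructure.pb, h1, h2, map_add, ContMDiffMap.coe_add, Pi.add_apply]
    push_cast
    ring

lemma PoissonStructure.pb_skew (P : PoissonStructure I M) (f g : SmoothC I M) (x : M) :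
    P.pb f g x = -P.pb g f x := by
  simp only [PoissonStructure.pb, P.skew f.re, P.skew f.im, ContMDiffMap.coe_neg, Pi.neg_apply]
  push_cast
  ring

/-- The bracket `{·, g}(x)` as an additive map. -/
def PoissonStructure.pbLeft (P : PoissonStructure I M) (g : SmoothC I M) (x : M) :
    SmoothC I M →+ ℂ :=
  -P.pbRight g x

@[simp] lemma PoissonStructure.pbRight_apply (P : PoissonStructure I M) (f g : SmoothC I M)
    (x : M) : P.pbRight f x g = P.pb f g x := rfl

@[simp] lemma PoissonStructure.pbLeft_apply (P : PoissonStructure I M) (f g : SmoothC I M)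
    (x : M) : P.pbLeft g x f = P.pb f g x := (P.pb_skew f g x).symm

lemma PoissonStructure.isPointDerivation_pbRight (P : PoissonStructure I M) (f : SmoothC I M)
    (x : M) : IsPointDerivation x (P.pbRight f x) where
  mul g h := by
    have h1 : (g * h).re = g.re * h.re - g.im * h.im := by
      ext y; exact Complex.mul_re _ _
    have h2 : (g * h).im = g.re * h.im + g.im * h.re := by
      ext y; exact Complex.mul_im _ _
    have e1 : ∀ k : SmoothC I M, k x = (k.re x : ℂ) + (k.im x : ℂ) * Complex.I :=
      fun k => (Complex.re_add_im (k x)).symm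
    simp only [pbRight_apply, PoissonStructure.pb, h1, h2, map_add, map_sub, P.leibniz,
      ContMDiffMap.coe_add, ContMDiffMap.coe_sub, ContMDiffMap.coe_mul, Pi.add_apply,
      Pi.sub_apply, Pi.mul_apply, e1 g, e1 h]
    push_cast
    ring_nf
    simp only [Complex.I_sq]
    ring
  const z := by
    have h1 := P.bracket_const f.re z.re (SmoothC.const z).re fun _ => rfl
    have h2 := P.bracket_const f.im z.re (SmoothC.const z).re fun _ => rfl
    have h3 := P.bracket_const f.re z.im (SmoothC.const z).im fun _ => rfl
    have h4 := P.bracket_const f.im z.im (SmoothC.const z).im fun _ => rfl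
    simp [PoissonStructure.pb, h1, h2, h3, h4]

lemma PoissonStructure.isPointDerivation_pbLeft (P : PoissonStructure I M) (g : SmoothC I M)
    (x : M) : IsPointDerivation x (P.pbLeft g x) where
  mul f h := by
    simp only [pbLeft, AddMonoidHom.neg_apply, (P.isPointDerivation_pbRight g x).mul]
    ring
  const z := by
    simp only [pbLeft, AddMonoidHom.neg_apply, (P.isPointDerivation_pbRight g x).const, neg_zero]

/-- The composition of a smooth function with an entire function. -/
def SmoothC.comp (F : ℂ → ℂ) (hF : Differentiable ℂ F) (f : SmoothC I M) : SmoothC I M :=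
  ⟨fun y => F (f y), ((hF.contDiff.restrict_scalars ℝ).contMDiff).comp f.contMDiff⟩

@[simp] lemma SmoothC.comp_apply (F : ℂ → ℂ) (hF : Differentiable ℂ F) (f : SmoothC I M) (x : M) :
    SmoothC.comp F hF f x = F (f x) := rfl

/-- Hadamard's trick: `F ∘ f = F(f x) + (f - f x) · (dslope F (f x) ∘ f)`, where the difference
quotient is again entire. The factor `f - f x` vanishes at `x`, so the Leibniz rule leaves only the
value `F'(f x)` of the quotient. No locality of `δ` is needed. -/
lemma IsPointDerivation.comp {x : M} {δ : SmoothC I M →+ ℂ} (hδ : IsPointDerivation x δ)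
    (F : ℂ → ℂ) (hF : Differentiable ℂ F) (f : SmoothC I M) :
    δ (SmoothC.comp F hF f) = deriv F (f x) * δ f := by
  have hG : Differentiable ℂ (dslope F (f x)) := by
    rw [← differentiableOn_univ] at hF ⊢
    exact (Complex.differentiableOn_dslope Filter.univ_mem).mpr hF
  have key : SmoothC.comp F hF f =
      SmoothC.const (F (f x)) + (f + SmoothC.const (-(f x))) * SmoothC.comp _ hG f := by
    ext y
    have h := sub_smul_dslope F (f x) (f y)
    simp only [smul_eq_mul] at h
    simp only [SmoothC.comp_apply, ContMDiffMap.coe_add, ContMDiffMap.coe_mul, Pi.add_apply,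
      Pi.mul_apply, SmoothC.const_apply]
    linear_combination -h
  rw [key, map_add, hδ.mul, map_add, hδ.const, hδ.const]
  simp only [SmoothC.comp_apply, dslope_same, ContMDiffMap.coe_add, Pi.add_apply,
    SmoothC.const_apply]
  ring

/-! ### Derivatives of matrix-valued functions -/

variable {n : Type*}

/-- `A` is a smooth matrix-valued function, and `B` is its derivative under `δ`. -/
def HasMatrixDeriv (δ : SmoothC I M →+ ℂ) (A : M → Matrix n n ℂ) (B : Matrix n n ℂ) : Prop :=
  ∃ Γ : Matrix n n (SmoothC I M), (∀ y, matrixEval Γ y = A y) ∧ Γ.map δ = B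

/-- A smooth function is determined by its values, so the derivative does not depend on the chosen
smooth lift. -/
lemma HasMatrixDeriv.map_eq {δ : SmoothC I M →+ ℂ} {A : M → Matrix n n ℂ} {B : Matrix n n ℂ}
    (h : HasMatrixDeriv δ A B) (Γ : Matrix n n (SmoothC I M)) (hΓ : ∀ y, matrixEval Γ y = A y) :
    Γ.map δ = B := by
  obtain ⟨Γ', h1, h2⟩ := h
  rw [← h2]
  congr 1
  ext i j y
  have := (hΓ y).trans (h1 y).symm
  exact congrFun (congrFun this i) j

lemma HasMatrixDeriv.unique {δ : SmoothC I M →+ ℂ} {A : M → Matrix n n ℂ} {B B' : Matrix n n ℂ}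
    (h : HasMatrixDeriv δ A B) (h' : HasMatrixDeriv δ A B') : B = B' := by
  obtain ⟨Γ, h1, h2⟩ := h
  rw [← h2, h'.map_eq Γ h1]

lemma HasMatrixDeriv.const {x : M} {δ : SmoothC I M →+ ℂ} (hδ : IsPointDerivation x δ)
    (A : Matrix n n ℂ) : HasMatrixDeriv δ (fun _ => A) 0 := by
  refine ⟨A.map SmoothC.const, fun y => ?_, ?_⟩
  · ext i j; simp [matrixEval]
  · ext i j; simp [hδ.const]

variable [Fintype n]

lemma matrixEval_mul (Γ Γ' : Matrix n n (SmoothC I M)) (y : M) :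
    matrixEval (Γ * Γ') y = matrixEval Γ y * matrixEval Γ' y := by
  ext i j
  simp only [matrixEval, Matrix.map_apply, Matrix.mul_apply]
  exact map_sum (⟨⟨fun f : SmoothC I M => f y, rfl⟩, fun _ _ => rfl⟩ : SmoothC I M →+ ℂ) _ _

lemma HasMatrixDeriv.mul {x : M} {δ : SmoothC I M →+ ℂ} (hδ : IsPointDerivation x δ)
    {A A' : M → Matrix n n ℂ} {B B' : Matrix n n ℂ}
    (h : HasMatrixDeriv δ A B) (h' : HasMatrixDeriv δ A' B') :
    HasMatrixDeriv δ (fun y => A y * A' y) (B * A' x + A x * B') := by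
  obtain ⟨Γ, h1, rfl⟩ := h
  obtain ⟨Γ', h1', rfl⟩ := h'
  refine ⟨Γ * Γ', fun y => by rw [matrixEval_mul, h1, h1'], ?_⟩
  rw [← h1, ← h1']
  ext i j
  simp only [Matrix.map_apply, Matrix.mul_apply, map_sum, hδ.mul, Finset.sum_add_distrib,
    Matrix.add_apply, matrixEval]

variable [DecidableEq n]

section

attribute [local instance] Matrix.linftyOpNormedRing Matrix.linftyOpNormedAlgebra

lemma hasDerivAt_exp_smul_apply (A : Matrix n n ℂ) (i j : n) (t : ℂ) :
    HasDerivAt (fun t : ℂ => NormedSpace.exp (t • A) i j)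
      ((A * NormedSpace.exp (t • A)) i j) t := by
  have h := hasDerivAt_exp_smul_const' (𝕂 := ℂ) A t
  have h2 := (LinearMap.toContinuousLinearMap
    (Matrix.entryLinearMap ℂ ℂ i j : Matrix n n ℂ →ₗ[ℂ] ℂ)).hasFDerivAt.comp_hasDerivAt t h
  exact h2

end

lemma HasMatrixDeriv.exp_smul {x : M} {δ : SmoothC I M →+ ℂ} (hδ : IsPointDerivation x δ)
    (f : SmoothC I M) (A : Matrix n n ℂ) :
    HasMatrixDeriv δ (fun y => NormedSpace.exp (f y • A))
      (δ f • (A * NormedSpace.exp (f x • A))) := by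
  have hd : ∀ i j, Differentiable ℂ fun t : ℂ => NormedSpace.exp (t • A) i j :=
    fun i j t => (hasDerivAt_exp_smul_apply A i j t).differentiableAt
  refine ⟨Matrix.of fun i j => SmoothC.comp _ (hd i j) f, fun y => rfl, ?_⟩
  ext i j
  simp only [Matrix.map_apply, Matrix.of_apply, hδ.comp, (hasDerivAt_exp_smul_apply A i j _).deriv,
    Matrix.smul_apply, smul_eq_mul]
  ring

lemma HasMatrixDeriv.exp_sum {x : M} {δ : SmoothC I M →+ ℂ} (hδ : IsPointDerivation x δ)
    {ι : Type*} (s : Finset ι) (f : ι → SmoothC I M) (A : ι → Matrix n n ℂ)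
    (hA : ∀ i j, Commute (A i) (A j)) :
    HasMatrixDeriv δ (fun y => NormedSpace.exp (∑ i ∈ s, f i y • A i))
      (NormedSpace.exp (∑ i ∈ s, f i x • A i) * ∑ i ∈ s, δ (f i) • A i) := by
  classical
  induction s using Finset.induction_on with
  | empty => simpa using HasMatrixDeriv.const hδ _
  | insert a s ha ih =>
    have hc : ∀ y, Commute (f a y • A a) (∑ i ∈ s, f i y • A i) := fun y =>
      Commute.sum_right _ _ _ fun i _ => ((hA a i).smul_left _).smul_right _
    have hc' : Commute (A a) (∑ i ∈ s, f i x • A i) :=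
      Commute.sum_right _ _ _ fun i _ => (hA a i).smul_right _
    have h := (HasMatrixDeriv.exp_smul hδ (f a) (A a)).mul hδ ih
    simp only [Finset.sum_insert ha, Matrix.exp_add_of_commute _ _ (hc _)]
    convert h using 1
    have h1 : A a * NormedSpace.exp (∑ i ∈ s, f i x • A i) =
        NormedSpace.exp (∑ i ∈ s, f i x • A i) * A a := by
      open scoped Matrix.Norms.Operator in exact hc'.exp_right.eq
    have h2 : A a * NormedSpace.exp (f a x • A a) = NormedSpace.exp (f a x • A a) * A a := by
      open scoped Matrix.Norms.Operator in
      exact ((Commute.refl (A a)).smul_right (f a x)).exp_right.eq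
    rw [mul_add, Matrix.mul_smul, smul_mul_assoc, h2, mul_assoc, mul_assoc, mul_assoc, h1]

end PointDerivation

/-! ### Conjugation by exponentials -/

section Conjugation

-- Left multiplication by `-a` and right multiplication by `a` commute, and their sum is `w ↦ ⁅w,
-- a⁆`; the exponential of the sum is therefore the composite of the two exponentials, which is
-- conjugation.
open scoped Nat in
lemma NormedSpace.hasSum_exp_conj {B : Type*} [NormedRing B] [NormedAlgebra ℂ B]
    [CompleteSpace B] (a v : B) :
    HasSum (fun k : ℕ => (k ! : ℂ)⁻¹ • (fun w => ⁅w, a⁆)^[k] v)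
      (NormedSpace.exp (-a) * v * NormedSpace.exp a) := by
  let m := ContinuousLinearMap.mul ℂ (B)
  have ev : ∀ T : B →L[ℂ] B, ∀ w,
      HasSum (fun k : ℕ => (k ! : ℂ)⁻¹ • T^[k] w) (NormedSpace.exp T w) := fun T w => by
    have h := (NormedSpace.exp_series_hasSum_exp' (𝕂 := ℂ) T).mapL
      (ContinuousLinearMap.apply ℂ (B) w)
    simpa [FunLike.coe_pow_eq_iterate] using h
  have hl : ∀ w, NormedSpace.exp (m (-a)) w = NormedSpace.exp (-a) * w := fun w => by
    refine (ev (m (-a)) w).unique ?_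
    have h := (NormedSpace.exp_series_hasSum_exp' (𝕂 := ℂ) (-a)).mul_right w
    refine (congrArg (HasSum · _) (funext fun k => ?_)).mpr h
    rw [smul_mul_assoc]
    congr 1
    induction k with
    | zero => simp
    | succ k ih => rw [Function.iterate_succ_apply', ih, pow_succ', mul_assoc]; rfl
  have hr : ∀ w, NormedSpace.exp (m.flip a) w = w * NormedSpace.exp a := fun w => by
    refine (ev (m.flip a) w).unique ?_
    have h := (NormedSpace.exp_series_hasSum_exp' (𝕂 := ℂ) a).mul_left w
    refine (congrArg (HasSum · _) (funext fun k => ?_)).mpr h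
    rw [mul_smul_comm]
    congr 1
    induction k with
    | zero => simp
    | succ k ih => rw [Function.iterate_succ_apply', ih, pow_succ, ← mul_assoc]; rfl
  let _ := NormedAlgebra.restrictScalars ℚ ℂ (B →L[ℂ] B)
  have hc : Commute (m (-a)) (m.flip a) := by
    ext1 w
    exact (mul_assoc (-a) w a).symm
  have h := ev (m (-a) + m.flip a) v
  rw [NormedSpace.exp_add_of_commute hc, mul_apply_eq_comp, hr, hl, ← mul_assoc] at h
  have e : ⇑(m (-a) + m.flip a) = fun w => ⁅w, a⁆ := by
    funext w
    simp [m, Ring.lie_def, sub_eq_add_neg, add_comm]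
  rwa [e] at h

variable {n : Type*} [Fintype n] [DecidableEq n]

section

attribute [local instance] Matrix.linftyOpNormedRing Matrix.linftyOpNormedAlgebra

open scoped Nat in
lemma hasSum_exp_conj (a v : Matrix n n ℂ) :
    HasSum (fun k : ℕ => (k ! : ℂ)⁻¹ • (fun w => ⁅w, a⁆)^[k] v)
      (NormedSpace.exp (-a) * v * NormedSpace.exp a) :=
  NormedSpace.hasSum_exp_conj a v

end

/-- On `W` the adjoint series turns under `φ` into the scalar series of `exp u`. The eigenvalue
property is asked only on `W` because `φ` will involve a linear retraction onto the Lie algebra,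
which respects brackets only on the image of `ρ`. -/
lemma map_exp_conj_of_lie (W : Submodule ℂ (Matrix n n ℂ)) (φ : Matrix n n ℂ →ₗ[ℂ] ℂ)
    (z : Matrix n n ℂ) (u : ℂ) (hW : ∀ w ∈ W, ⁅w, z⁆ ∈ W) (hφ : ∀ w ∈ W, φ ⁅w, z⁆ = u * φ w)
    {v : Matrix n n ℂ} (hv : v ∈ W) :
    φ (NormedSpace.exp (-z) * v * NormedSpace.exp z) = Complex.exp u * φ v := by
  have h := (hasSum_exp_conj z v).mapL (LinearMap.toContinuousLinearMap φ)
  have hk : ∀ k : ℕ, (fun w => ⁅w, z⁆)^[k] v ∈ W ∧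
      φ ((fun w => ⁅w, z⁆)^[k] v) = u ^ k * φ v := fun k => by
    induction k with
    | zero => simp [hv]
    | succ k ih =>
      rw [Function.iterate_succ_apply']
      exact ⟨hW _ ih.1, by rw [hφ _ ih.1, ih.2, pow_succ']; ring⟩
  have h2 := (NormedSpace.exp_series_hasSum_exp' (𝕂 := ℂ) u).mul_right (φ v)
  rw [← Complex.exp_eq_exp_ℂ] at h2
  refine h.unique ?_
  refine (congrArg (HasSum · _) (funext fun k => ?_)).mpr h2
  simp [(hk k).2, mul_assoc]

/-- A decreasing filtration such that bracketing with its first step raises the degree. -/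
structure IsLieFiltration (V : ℕ → Submodule ℂ (Matrix n n ℂ)) : Prop where
  anti : Antitone V
  lie : ∀ a ∈ V 1, ∀ k, ∀ w ∈ V k, ⁅w, a⁆ ∈ V (k + 1)

/-- The terms of the adjoint series of order at least two lie in `V (k + 2)`, and so does their sum,
a finite-dimensional subspace being closed. -/
lemma IsLieFiltration.exp_conj {V : ℕ → Submodule ℂ (Matrix n n ℂ)} (hV : IsLieFiltration V)
    {a v : Matrix n n ℂ} (ha : a ∈ V 1) {k : ℕ} (hv : v ∈ V k) :
    NormedSpace.exp (-a) * v * NormedSpace.exp a - v - ⁅v, a⁆ ∈ V (k + 2) := by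
  have h := (hasSum_nat_add_iff' 2).mpr (hasSum_exp_conj a v)
  have hk : ∀ j : ℕ, (fun w => ⁅w, a⁆)^[j] v ∈ V (k + j) := fun j => by
    induction j with
    | zero => simpa using hv
    | succ j ih => rw [Function.iterate_succ_apply']; exact hV.lie a ha _ _ ih
  simp only [Finset.sum_range_succ, Finset.sum_range_zero, zero_add, Nat.factorial_zero,
    Nat.factorial_one, Nat.cast_one, inv_one, one_smul, Function.iterate_zero, id,
    Function.iterate_one, ← sub_sub] at h
  have hcl : IsClosed (V (k + 2) : Set (Matrix n n ℂ)) := (V (k + 2)).closed_of_finiteDimensional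
  refine hcl.mem_of_tendsto h (Filter.Eventually.of_forall fun s => ?_)
  exact Submodule.sum_mem _ fun j _ => Submodule.smul_mem _ _
    (hV.anti (show k + 2 ≤ k + (j + 2) by omega) (hk (j + 2)))

/-- The ordered product of the exponentials `exp (t a)`. -/
def expProd (l : List (ℂ × Matrix n n ℂ)) : Matrix n n ℂ :=
  (l.map fun p => NormedSpace.exp (p.1 • p.2)).prod

lemma expProd_cons (p : ℂ × Matrix n n ℂ) (l : List (ℂ × Matrix n n ℂ)) :
    expProd (p :: l) = NormedSpace.exp (p.1 • p.2) * expProd l := by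
  simp [expProd]

lemma isUnit_expProd (l : List (ℂ × Matrix n n ℂ)) : IsUnit (expProd l) := by
  induction l with
  | nil => simp [expProd]
  | cons p l ih => rw [expProd_cons]; exact (Matrix.isUnit_exp _).mul ih

lemma expProd_inv (l : List (ℂ × Matrix n n ℂ)) :
    (expProd l)⁻¹ = expProd (l.map fun p => (-p.1, p.2)).reverse := by
  rw [expProd, Matrix.list_prod_inv_reverse, expProd, ← List.map_reverse, ← List.map_reverse,
    List.map_map, List.map_map]
  simp [Function.comp_def, Matrix.exp_neg]

/-- Conjugating by the first factor moves `v` to some `w` with `w - v ∈ V (k + 1)`. Replacing `w` by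
`v` in the remaining first-order brackets costs only terms of `V (k + 2)`, so the first-order
contributions add up. -/
lemma IsLieFiltration.expProd_conj {V : ℕ → Submodule ℂ (Matrix n n ℂ)} (hV : IsLieFiltration V)
    (l : List (ℂ × Matrix n n ℂ)) (hl : ∀ p ∈ l, p.2 ∈ V 1) {v : Matrix n n ℂ} {k : ℕ}
    (hv : v ∈ V k) :
    (expProd l)⁻¹ * v * expProd l - v - (l.map fun p => p.1 • ⁅v, p.2⁆).sum ∈ V (k + 2) := by
  induction l generalizing v k with
  | nil => simp [expProd]
  | cons p l ih =>
    have hp := Submodule.smul_mem (V 1) p.1 (hl p (by simp))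
    have hl' : ∀ q ∈ l, q.2 ∈ V 1 := fun q hq => hl q (by simp [hq])
    set w := NormedSpace.exp (-(p.1 • p.2)) * v * NormedSpace.exp (p.1 • p.2) with hw
    have h1 := hV.exp_conj hp hv
    have h0 : ⁅v, p.1 • p.2⁆ ∈ V (k + 1) := hV.lie _ hp _ _ hv
    have hwv : w - v ∈ V (k + 1) := by
      have := Submodule.add_mem _ (hV.anti (show k + 1 ≤ k + 2 by omega) h1) h0
      simpa using this
    have hwk : w ∈ V k := by
      have := Submodule.add_mem _ (hV.anti (Nat.le_succ k) hwv) hv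
      simpa using this
    have h2 := ih hl' hwk
    have h3 : (l.map fun p => p.1 • ⁅w, p.2⁆).sum - (l.map fun p => p.1 • ⁅v, p.2⁆).sum ∈
        V (k + 2) := by
      clear h2 ih hl
      induction l with
      | nil => simp
      | cons q l ih =>
        have hq := Submodule.smul_mem _ q.1 (hV.lie _ (hl' q (by simp)) _ _ hwv)
        rw [sub_lie, smul_sub] at hq
        have := Submodule.add_mem _ hq (ih fun r hr => hl' r (by simp [hr]))
        simp only [List.map_cons, List.sum_cons]
        convert this using 1
        abel
    have e : (expProd (p :: l))⁻¹ * v * expProd (p :: l) = (expProd l)⁻¹ * w * expProd l := by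
      rw [expProd_cons, Matrix.mul_inv_rev, ← Matrix.exp_neg, hw]
      simp only [mul_assoc]
    rw [e]
    have := Submodule.add_mem _ (Submodule.add_mem _ h2 h3) h1
    simp only [List.map_cons, List.sum_cons]
    rw [lie_smul] at this
    convert this using 1
    abel

variable {E : Type*} [NormedAddCommGroup E] [NormedSpace ℝ E]
  {X : Type*} [TopologicalSpace X] {I : ModelWithCorners ℝ E X}
  {M : Type*} [TopologicalSpace M] [ChartedSpace X M]

/-- The values at a point of the coefficients of a list of exponents. -/
def exponentsAt (l : List (SmoothC I M × Matrix n n ℂ)) (x : M) : List (ℂ × Matrix n n ℂ) :=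
  l.map fun p => (p.1 x, p.2)

/-- `B` is the logarithmic derivative of the product. Each factor contributes its own exponent
conjugated by the factors to its right, which changes it only by an element of `V 2`. -/
lemma IsLieFiltration.exists_hasMatrixDeriv_expProd {V : ℕ → Submodule ℂ (Matrix n n ℂ)}
    (hV : IsLieFiltration V) {x : M} {δ : SmoothC I M →+ ℂ} (hδ : IsPointDerivation x δ)
    (l : List (SmoothC I M × Matrix n n ℂ)) (hl : ∀ p ∈ l, p.2 ∈ V 1) :
    ∃ B : Matrix n n ℂ, HasMatrixDeriv δ (fun y => expProd (exponentsAt l y))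
        (expProd (exponentsAt l x) * B) ∧
      B - (l.map fun p => δ p.1 • p.2).sum ∈ V 2 ∧ B ∈ V 1 := by
  induction l with
  | nil => exact ⟨0, by simpa [exponentsAt, expProd] using HasMatrixDeriv.const hδ _, by simp,
      by simp⟩
  | cons p l ih =>
    obtain ⟨B, h1, h2, h3⟩ := ih fun q hq => hl q (by simp [hq])
    have hp := Submodule.smul_mem (V 1) (δ p.1) (hl p (by simp))
    set m := expProd (exponentsAt l x) with hm
    have hu : IsUnit m.det := (Matrix.isUnit_iff_isUnit_det _).mp (isUnit_expProd _)
    have hl' : ∀ q ∈ exponentsAt l x, q.2 ∈ V 1 := by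
      intro q hq
      simp only [exponentsAt, List.mem_map] at hq
      obtain ⟨r, hr, rfl⟩ := hq
      exact hl r (by simp [hr])
    have h4 := hV.expProd_conj (exponentsAt l x) hl' hp
    have h5 : ((exponentsAt l x).map fun q => q.1 • ⁅δ p.1 • p.2, q.2⁆).sum ∈ V 2 := by
      refine list_sum_mem fun r hr => ?_
      obtain ⟨q, hq, rfl⟩ := List.mem_map.mp hr
      exact Submodule.smul_mem _ _ (hV.lie _ (hl' q hq) _ _ hp)
    have h6 : m⁻¹ * (δ p.1 • p.2) * m - δ p.1 • p.2 ∈ V 2 := by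
      have := Submodule.add_mem _ (hV.anti (show 2 ≤ 1 + 2 by omega) h4) h5
      simpa using this
    refine ⟨m⁻¹ * (δ p.1 • p.2) * m + B, ?_, ?_, ?_⟩
    · have h := (HasMatrixDeriv.exp_smul hδ p.1 p.2).mul hδ h1
      have e : ∀ y, expProd (exponentsAt (p :: l) y) =
          NormedSpace.exp (p.1 y • p.2) * expProd (exponentsAt l y) := fun y => by
        simp [exponentsAt, expProd]
      simp only [e]
      convert h using 1
      have hc : p.2 * NormedSpace.exp (p.1 x • p.2) = NormedSpace.exp (p.1 x • p.2) * p.2 := by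
        open scoped Matrix.Norms.Operator in
        exact ((Commute.refl p.2).smul_right (p.1 x)).exp_right.eq
      rw [← hm, hc, mul_add]
      congr 1
      · simp only [Matrix.mul_smul, Matrix.smul_mul, mul_assoc]
        rw [Matrix.mul_nonsing_inv_cancel_left _ _ hu]
      · rw [mul_assoc]
    · have := Submodule.add_mem _ h6 h2
      simp only [List.map_cons, List.sum_cons]
      convert this using 1
      abel
    · have := Submodule.add_mem _ (Submodule.add_mem _ (hV.anti (show 1 ≤ 2 by omega) h6) hp) h3
      simpa using this

end Conjugation

/-! ### The height filtration and its pairing with root vectors -/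

section Height

variable {L : Type*} [LieRing L] [LieAlgebra ℂ L]

/-- The span of the eigenvectors of `ad g` with natural eigenvalues at least `k`. -/
def heightStep (g : L) (k : ℕ) : Submodule ℂ L :=
  Submodule.span ℂ {y | ∃ m : ℕ, k ≤ m ∧ ⁅g, y⁆ = (m : ℂ) • y}

lemma mem_heightStep {g y : L} {k m : ℕ} (hkm : k ≤ m) (hy : ⁅g, y⁆ = (m : ℂ) • y) :
    y ∈ heightStep g k :=
  Submodule.subset_span ⟨m, hkm, hy⟩

lemma heightStep_antitone (g : L) : Antitone (heightStep g) := fun _ _ h =>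
  Submodule.span_mono fun _ ⟨m, hm, hy⟩ => ⟨m, h.trans hm, hy⟩

lemma lie_mem_heightStep {g x y : L} {j k : ℕ} (hx : x ∈ heightStep g j)
    (hy : y ∈ heightStep g k) : ⁅x, y⁆ ∈ heightStep g (j + k) := by
  induction hx using Submodule.span_induction with
  | zero => simp
  | add x x' _ _ h h' => rw [add_lie]; exact Submodule.add_mem _ h h'
  | smul t x _ h => rw [smul_lie]; exact Submodule.smul_mem _ _ h
  | mem x hx =>
    obtain ⟨m, hm, hx⟩ := hx
    induction hy using Submodule.span_induction with
    | zero => simp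
    | add y y' _ _ h h' => rw [lie_add]; exact Submodule.add_mem _ h h'
    | smul t y _ h => rw [lie_smul]; exact Submodule.smul_mem _ _ h
    | mem y hy =>
      obtain ⟨m', hm', hy⟩ := hy
      refine mem_heightStep (Nat.add_le_add hm hm') ?_
      rw [leibniz_lie, hx, hy, smul_lie, lie_smul, ← add_smul]
      push_cast
      rfl

lemma killingForm_lie_left (x y z : L) :
    killingForm ℂ L ⁅x, y⁆ z = killingForm ℂ L x ⁅y, z⁆ :=
  LieModule.traceForm_apply_lie_apply ℂ L L x y z

lemma killingForm_comm (x y : L) : killingForm ℂ L x y = killingForm ℂ L y x :=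
  LieModule.traceForm_comm ℂ L L x y

/-- By invariance of `κ`, a vector of height `-j` pairs nontrivially only with height `j`; every
height present in `y` is at least `k > j`. -/
lemma killingForm_eq_zero_of_mem_heightStep {g U y : L} {j k : ℕ} (hU : ⁅g, U⁆ = -(j : ℂ) • U)
    (hjk : j < k) (hy : y ∈ heightStep g k) : killingForm ℂ L U y = 0 := by
  induction hy using Submodule.span_induction with
  | zero => simp
  | add y y' _ _ h h' => rw [map_add, h, h', add_zero]
  | smul t y _ h => rw [map_smul, h, smul_zero]
  | mem y hy =>
    obtain ⟨m, hm, hy⟩ := hy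
    have h1 := killingForm_lie_left U g y
    rw [hy, ← lie_skew, hU, map_neg, map_smul, map_smul] at h1
    simp only [LinearMap.neg_apply, LinearMap.smul_apply, smul_eq_mul] at h1
    have h2 : ((m : ℂ) - j) ≠ 0 := by
      rw [sub_ne_zero]
      exact_mod_cast (show m ≠ j by omega)
    have h3 : ((m : ℂ) - j) * killingForm ℂ L U y = 0 := by linear_combination -h1
    exact (mul_eq_zero.mp h3).resolve_left h2

variable {n : Type*} [Fintype n] [DecidableEq n] (ρ : L →ₗ⁅ℂ⁆ Matrix n n ℂ)

lemma isLieFiltration_heightStep (g : L) :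
    IsLieFiltration fun k => (heightStep g k).map (ρ : L →ₗ[ℂ] Matrix n n ℂ) where
  anti _ _ h := Submodule.map_mono (heightStep_antitone g h)
  lie := by
    rintro _ ⟨a, ha, rfl⟩ k _ ⟨w, hw, rfl⟩
    exact ⟨⁅w, a⁆, lie_mem_heightStep hw ha, LieHom.map_lie ρ w a⟩

/-! ### Gauss factors: ordered products of exponentials times a Cartan exponential -/

section Gauss

variable {E : Type*} [NormedAddCommGroup E] [NormedSpace ℝ E]
  {X : Type*} [TopologicalSpace X] {I : ModelWithCorners ℝ E X}
  {M : Type*} [TopologicalSpace M] [ChartedSpace X M]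

/-- The list of exponents in a representation. -/
def repExponents (l : List (SmoothC I M × L)) : List (SmoothC I M × Matrix n n ℂ) :=
  l.map fun p => (p.1, ρ p.2)

/-- An ordered product of exponentials times `exp (∑ fᵢ Bᵢ)`. -/
def gaussProd {ι : Type*} [Fintype ι] (l : List (SmoothC I M × L)) (f : ι → SmoothC I M)
    (B : ι → L) (y : M) : Matrix n n ℂ :=
  expProd (exponentsAt (repExponents ρ l) y) * NormedSpace.exp (ρ (∑ i, f i y • B i))

variable {ρ} {s : Matrix n n ℂ →ₗ[ℂ] L} (hs : ∀ y, s (ρ y) = y) {ι : Type*} [Fintype ι]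
  {l : List (SmoothC I M × L)} {f : ι → SmoothC I M} {B : ι → L} {g U : L} {j : ℕ} {u : ℂ} {x : M}

lemma isUnit_gaussProd : IsUnit (gaussProd ρ l f B x) :=
  (isUnit_expProd _).mul (Matrix.isUnit_exp _)

-- Invariance moves each bracket with `Z` onto the eigenvector `U`: `κ(U, ⁅y, Z⁆) = -κ(⁅U, Z⁆, y) =
-- -u κ(U, y)`.
include hs in
lemma killingForm_exp_conj {Z : L} (hu : ⁅U, Z⁆ = u • U) (w : L) :
    killingForm ℂ L U (s (NormedSpace.exp (-ρ Z) * ρ w * NormedSpace.exp (ρ Z))) =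
      Complex.exp (-u) * killingForm ℂ L U w := by
  have h := map_exp_conj_of_lie (LinearMap.range (ρ : L →ₗ[ℂ] Matrix n n ℂ))
    (killingForm ℂ L U ∘ₗ s) (ρ Z) (-u) ?_ ?_ (v := ρ w) ⟨w, rfl⟩
  · simpa [hs] using h
  · rintro _ ⟨y, rfl⟩
    exact ⟨⁅y, Z⁆, LieHom.map_lie ρ y Z⟩
  · rintro _ ⟨y, rfl⟩
    have e : ⁅ρ y, ρ Z⁆ = ρ ⁅y, Z⁆ := (LieHom.map_lie ρ y Z).symm
    have : ⁅(ρ : L →ₗ[ℂ] Matrix n n ℂ) y, ρ Z⁆ = ρ ⁅y, Z⁆ := e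
    simp only [LinearMap.comp_apply, this, hs]
    rw [← lie_skew, map_neg, ← killingForm_lie_left, hu, map_smul]
    simp [hs]

include hs in
lemma killingForm_exp_conj_of_sub_mem {Z : L} (hu : ⁅U, Z⁆ = u • U)
    (hU : ⁅g, U⁆ = -(j : ℂ) • U) (hj : j < 2) {v : Matrix n n ℂ} {w : L}
    (hv : v - ρ w ∈ (heightStep g 2).map (ρ : L →ₗ[ℂ] Matrix n n ℂ)) :
    killingForm ℂ L U (s (NormedSpace.exp (-ρ Z) * v * NormedSpace.exp (ρ Z))) =
      Complex.exp (-u) * killingForm ℂ L U w := by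
  obtain ⟨r, hr, hr'⟩ := hv
  have : v = ρ (w + r) := by
    rw [map_add]
    exact (add_eq_of_eq_sub' hr').symm
  rw [this, killingForm_exp_conj hs hu, map_add,
    killingForm_eq_zero_of_mem_heightStep hU hj hr, add_zero]

include hs in
/-- The pairing of `G⁻¹ ρ(b) G` with a vector of small height. -/
lemma killingForm_gaussProd_conj (hl : ∀ p ∈ l, p.2 ∈ heightStep g 1)
    (hu : ⁅U, ∑ i, f i x • B i⁆ = u • U) (hU : ⁅g, U⁆ = -(j : ℂ) • U) (hj : j < 2)
    {b : L} (hb : b ∈ heightStep g 0) :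
    killingForm ℂ L U (s ((gaussProd ρ l f B x)⁻¹ * ρ b * gaussProd ρ l f B x)) =
      Complex.exp (-u) * (killingForm ℂ L U b +
        (l.map fun p => p.1 x * killingForm ℂ L U ⁅b, p.2⁆).sum) := by
  have h := (isLieFiltration_heightStep ρ g).expProd_conj (exponentsAt (repExponents ρ l) x) ?_
    (v := ρ b) (k := 0) ⟨b, hb, rfl⟩
  · have e : ((exponentsAt (repExponents ρ l) x).map fun p => p.1 • ⁅ρ b, p.2⁆).sum =
        ρ ((l.map fun p => p.1 x • ⁅b, p.2⁆).sum) := by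
      clear h hl
      induction l with
      | nil => simp [exponentsAt, repExponents]
      | cons p l ih =>
        simp only [exponentsAt, repExponents, List.map_cons, List.sum_cons] at ih ⊢
        rw [ih, map_add, map_smul, LieHom.map_lie]
    rw [e, sub_sub, ← map_add] at h
    have h2 := killingForm_exp_conj_of_sub_mem hs hu hU hj h
    rw [gaussProd, Matrix.mul_inv_rev, ← Matrix.exp_neg]
    simp only [mul_assoc] at h2 ⊢
    rw [h2, map_add, map_list_sum, List.map_map]
    simp [Function.comp_def]
  · intro p hp
    simp only [exponentsAt, repExponents, List.map_map, List.mem_map] at hp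
    obtain ⟨q, hq, rfl⟩ := hp
    exact ⟨q.2, hl q hq, rfl⟩

include hs in
/-- The pairing of the logarithmic derivative `G⁻¹ δG` with a vector of small height. -/
lemma exists_hasMatrixDeriv_gaussProd (hl : ∀ p ∈ l, p.2 ∈ heightStep g 1)
    (hB : ∀ i k, ⁅B i, B k⁆ = 0)
    (hu : ⁅U, ∑ i, f i x • B i⁆ = u • U) (hU : ⁅g, U⁆ = -(j : ℂ) • U) (hj : j < 2)
    {δ : SmoothC I M →+ ℂ} (hδ : IsPointDerivation x δ) :
    ∃ C, HasMatrixDeriv δ (gaussProd ρ l f B) C ∧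
      killingForm ℂ L U (s ((gaussProd ρ l f B x)⁻¹ * C)) =
        Complex.exp (-u) * (l.map fun p => δ p.1 * killingForm ℂ L U p.2).sum +
          ∑ i, δ (f i) * killingForm ℂ L U (B i) := by
  obtain ⟨C, h1, h2, -⟩ := (isLieFiltration_heightStep ρ g).exists_hasMatrixDeriv_expProd hδ
    (repExponents ρ l) (by
      intro p hp
      obtain ⟨q, hq, rfl⟩ := List.mem_map.mp hp
      exact ⟨q.2, hl q hq, rfl⟩)
  have e : ((repExponents ρ l).map fun p => δ p.1 • p.2).sum =
      ρ ((l.map fun p => δ p.1 • p.2).sum) := by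
    clear h1 h2 hl
    induction l with
    | nil => simp [repExponents]
    | cons p l ih =>
      simp only [repExponents, List.map_cons, List.sum_cons] at ih ⊢
      rw [ih, map_add, map_smul]
  rw [e] at h2
  have hc : ∀ i k, Commute (ρ (B i)) (ρ (B k)) := fun i k => by
    have h := LieHom.map_lie ρ (B i) (B k)
    rw [hB, map_zero, Ring.lie_def] at h
    exact (sub_eq_zero.mp h.symm)
  have h3 := HasMatrixDeriv.exp_sum hδ Finset.univ f (fun i => ρ (B i)) hc
  have hsum : ∀ v : ι → ℂ, ∑ i, v i • ρ (B i) = ρ (∑ i, v i • B i) := fun v => by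
    simp [map_sum]
  simp only [hsum] at h3
  refine ⟨_, h1.mul hδ h3, ?_⟩
  have h4 := killingForm_exp_conj_of_sub_mem hs hu hU hj h2
  set m := expProd (exponentsAt (repExponents ρ l) x) with hm
  set D := NormedSpace.exp (ρ (∑ i, f i x • B i)) with hD
  have hmu : IsUnit m.det := (Matrix.isUnit_iff_isUnit_det _).mp (isUnit_expProd _)
  have hDu : IsUnit D.det := (Matrix.isUnit_iff_isUnit_det _).mp (Matrix.isUnit_exp _)
  -- With `G = m D`, `G⁻¹ δG = D⁻¹ (m⁻¹ δm) D + D⁻¹ δD`. As `D` stands on the right, the Cartan term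
  -- appears unconjugated.
  have e2 : (gaussProd ρ l f B x)⁻¹ * (m * C * D + m * (D * ρ (∑ i, δ (f i) • B i))) =
      NormedSpace.exp (-ρ (∑ i, f i x • B i)) * C * D + ρ (∑ i, δ (f i) • B i) := by
    rw [gaussProd, Matrix.mul_inv_rev, Matrix.exp_neg, ← hm, ← hD, mul_add]
    congr 1
    · simp only [mul_assoc]
      rw [Matrix.nonsing_inv_mul_cancel_left _ _ hmu]
    · rw [mul_assoc, Matrix.nonsing_inv_mul_cancel_left _ _ hmu,
        Matrix.nonsing_inv_mul_cancel_left _ _ hDu]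
  rw [e2, map_add, map_add, h4, hs, map_sum, map_list_sum, List.map_map]
  simp [Function.comp_def]

end Gauss

end Height

/-! ### Contracting the mixed bracket -/

section Contraction

open LieAlgebra

variable {n : Type*}

/-- The tensor product of two functionals on matrices, evaluated on Kronecker matrices. -/
def matrixPairing (Φ Ψ : Matrix n n ℂ →ₗ[ℂ] ℂ) : Matrix (n × n) (n × n) ℂ →ₗ[ℂ] ℂ where
  toFun T := Φ (Matrix.of fun i j => Ψ (Matrix.of fun k l => T (i, k) (j, l)))
  map_add' S T := by
    rw [← map_add]
    congr 1
    ext i j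
    simp only [Matrix.of_apply, Matrix.add_apply]
    rw [← map_add]
    rfl
  map_smul' t T := by
    rw [RingHom.id_apply, ← map_smul]
    congr 1
    ext i j
    simp only [Matrix.of_apply, Matrix.smul_apply]
    rw [← map_smul]
    rfl

lemma matrixPairing_kronecker (Φ Ψ : Matrix n n ℂ →ₗ[ℂ] ℂ) (A B : Matrix n n ℂ) :
    matrixPairing Φ Ψ (A ⊗ₖ B) = Φ A * Ψ B := by
  have h : ∀ i j, (Matrix.of fun k l => (A ⊗ₖ B) (i, k) (j, l)) = A i j • B := fun i j => rfl
  have h2 : (Matrix.of fun i j => Ψ (A i j • B)) = Ψ B • A := by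
    ext i j
    simp [mul_comm]
  change Φ (Matrix.of fun i j => Ψ (Matrix.of fun k l => (A ⊗ₖ B) (i, k) (j, l))) = _
  simp only [h]
  rw [h2, map_smul, smul_eq_mul, mul_comm]

variable {L : Type*} [LieRing L] [LieAlgebra ℂ L] [FiniteDimensional ℂ L] [IsKilling ℂ L]
  [Fintype n] [DecidableEq n] (ρ : L →ₗ⁅ℂ⁆ Matrix n n ℂ)

lemma matrixPairing_tensorRep_mul (Φ Ψ : Matrix n n ℂ →ₗ[ℂ] ℂ) (A B : Matrix n n ℂ) (Y : L)
    (hΨ : ∀ b, Ψ (ρ b * B) = killingForm ℂ L b Y) (r : L ⊗[ℂ] L) :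
    matrixPairing Φ Ψ (tensorRep ρ r * (A ⊗ₖ B)) = Φ (ρ (killingContract r Y) * A) := by
  induction r using TensorProduct.induction_on with
  | zero => simp
  | add r r' h h' => simp only [map_add, add_mul, h, h', LinearMap.add_apply]
  | tmul a b =>
    have : tensorRep ρ (a ⊗ₜ[ℂ] b) = ρ a ⊗ₖ ρ b := rfl
    rw [this, ← Matrix.mul_kronecker_mul, matrixPairing_kronecker, hΨ, killingContract_tmul,
      map_smul, Matrix.smul_mul, map_smul, smul_eq_mul, mul_comm]

/-- Contracting the first leg of `r` with `U` gives the Killing adjoint of `killingContract r`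
applied to `U`; nondegeneracy of `κ` identifies it with `W`. -/
lemma matrixPairing_mul_tensorRep (Φ Ψ : Matrix n n ℂ →ₗ[ℂ] ℂ) (A B : Matrix n n ℂ) (U W : L)
    (hΦ : ∀ a, Φ (A * ρ a) = killingForm ℂ L U a) (r : L ⊗[ℂ] L)
    (hW : ∀ Y, killingForm ℂ L W Y = killingForm ℂ L U (killingContract r Y)) :
    matrixPairing Φ Ψ ((A ⊗ₖ B) * tensorRep ρ r) = Ψ (B * ρ W) := by
  let c : L ⊗[ℂ] L →ₗ[ℂ] L := TensorProduct.lid ℂ L ∘ₗ (killingForm ℂ L U).rTensor L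
  have h1 : ∀ r Y, killingForm ℂ L (c r) Y = killingForm ℂ L U (killingContract r Y) := by
    intro r Y
    induction r using TensorProduct.induction_on with
    | zero => simp
    | add r r' h h' => simp only [map_add, LinearMap.add_apply, h, h']
    | tmul a b => simp [c, killingContract_tmul, mul_comm]
  have h2 : ∀ r, matrixPairing Φ Ψ ((A ⊗ₖ B) * tensorRep ρ r) = Ψ (B * ρ (c r)) := by
    intro r
    induction r using TensorProduct.induction_on with
    | zero => simp
    | add r r' h h' => simp only [map_add, mul_add, h, h']
    | tmul a b =>
      have : tensorRep ρ (a ⊗ₜ[ℂ] b) = ρ a ⊗ₖ ρ b := rfl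
      rw [this, ← Matrix.mul_kronecker_mul, matrixPairing_kronecker, hΦ]
      simp [c]
  have h3 : c r = W := by
    have : killingForm ℂ L (c r) = killingForm ℂ L W := LinearMap.ext fun Y => by rw [h1, hW]
    exact LinearMap.ker_eq_bot.mp (LieAlgebra.IsKilling.ker_killingForm_eq_bot ℂ L) this
  rw [h2, h3]

variable {E : Type*} [NormedAddCommGroup E] [NormedSpace ℝ E]
  {X : Type*} [TopologicalSpace X] {I : ModelWithCorners ℝ E X}
  {M : Type*} [TopologicalSpace M] [ChartedSpace X M]

-- The bracket is a derivation in each argument. With the first entry fixed, `Ψ` collapses the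
-- second matrix to `t' {Γ i j, q}`; then `{·, q}` is a derivation and `Φ` collapses the first
-- matrix to `t {p, q}`.
variable {ρ} in
lemma QuadraticPB.contract {P : PoissonStructure I M} {γ : ℝ} {T : L →ₗ[ℂ] L}
    {Γ Γ' : Matrix n n (SmoothC I M)} (h : QuadraticPB ρ P γ (killingKernel T) Γ Γ') (x : M)
    (Φ Ψ : Matrix n n ℂ →ₗ[ℂ] ℂ) {p q : SmoothC I M} {t t' : ℂ}
    (ht : ∀ δ, IsPointDerivation x δ → Φ (Γ.map δ) = t * δ p)
    (ht' : ∀ δ, IsPointDerivation x δ → Ψ (Γ'.map δ) = t' * δ q) {U W Y : L}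
    (hΦ : ∀ a, Φ (matrixEval Γ x * ρ a) = killingForm ℂ L U a)
    (hΨ : ∀ b, Ψ (ρ b * matrixEval Γ' x) = killingForm ℂ L b Y)
    (hW : ∀ Y, killingForm ℂ L W Y = killingForm ℂ L U (T Y)) :
    t * t' * P.pb p q x =
      γ * (Φ (ρ (T Y) * matrixEval Γ x) - Ψ (matrixEval Γ' x * ρ W)) := by
  have hT : killingContract (killingKernel T) = T := LinearEquiv.apply_symm_apply _ _
  have h1 := congrArg (matrixPairing Φ Ψ) (h x)
  rw [map_smul, map_sub, matrixPairing_tensorRep_mul ρ Φ Ψ _ _ Y hΨ,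
    matrixPairing_mul_tensorRep ρ Φ Ψ _ _ U W hΦ _ (by simpa only [hT] using hW), hT,
    smul_eq_mul] at h1
  rw [← h1]
  have h2 : ∀ i j, Ψ (Matrix.of fun k l => P.tensorPB Γ Γ' x (i, k) (j, l)) =
      t' * P.pb (Γ i j) q x := fun i j =>
    ht' _ (P.isPointDerivation_pbRight (Γ i j) x)
  change _ = Φ (Matrix.of fun i j => Ψ (Matrix.of fun k l => P.tensorPB Γ Γ' x (i, k) (j, l)))
  simp only [h2]
  have h3 := ht _ (P.isPointDerivation_pbLeft q x)
  have h4 : (Matrix.of fun i j => t' * P.pb (Γ i j) q x) = t' • Γ.map (P.pbLeft q x) := by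
    ext i j
    simp
  rw [h4, map_smul, h3, P.pbLeft_apply, smul_eq_mul]
  ring

end Contraction

/-! ### Root vectors, fundamental coweights and the standard `R`-matrix -/

section Roots

open LieAlgebra LieAlgebra.IsKilling

variable {L : Type*} [LieRing L] [LieAlgebra ℂ L] {H : LieSubalgebra ℂ L} [H.IsCartanSubalgebra]

/-- The condition on `S` is conditional so that `χ` need not be a weight: if it is not, its space is
zero and so is `y`. -/
lemma mem_weightSum {S : Set (LieModule.Weight ℂ H L)} {χ : H → ℂ} {y : L}
    (hy : y ∈ rootSpace H χ) (hS : ∀ ψ : LieModule.Weight ℂ H L, (ψ : H → ℂ) = χ → ψ ∈ S) :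
    y ∈ weightSum H S := by
  by_cases h0 : y = 0
  · rw [h0]; exact Submodule.zero_mem _
  · let ψ : LieModule.Weight ℂ H L := ⟨χ, fun hb => h0 (by
      have : y ∈ (⊥ : LieSubmodule ℂ H L) := hb ▸ hy
      simpa using this)⟩
    exact Submodule.mem_iSup_of_mem ψ (Submodule.mem_iSup_of_mem (hS ψ rfl) hy)

variable [FiniteDimensional ℂ L]

lemma killingForm_eq_zero_of_mem_rootSpace {χ ψ : H → ℂ} {x y : L} (hx : x ∈ rootSpace H χ)
    (hy : y ∈ rootSpace H ψ) (h : ψ ≠ -χ) : killingForm ℂ L x y = 0 :=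
  killingForm_apply_eq_zero_of_mem_rootSpace_of_add_ne_zero ℂ L H hx hy
    fun h0 => h (eq_neg_of_add_eq_zero_right h0)

lemma mem_rootSpace_zero (h : H) : (h : L) ∈ rootSpace H (0 : H → ℂ) := by
  rw [rootSpace_zero_eq]
  exact h.2

lemma root_ne_zero (α : H.root) : (α.1 : H → ℂ) ≠ 0 := (LieSubalgebra.isNonZero_coe_root α)

lemma killingForm_cartan_of_mem_rootSpace {α : H.root} {x : L} (hx : x ∈ rootSpace H α.1) (h : H) :
    killingForm ℂ L x h = 0 :=
  killingForm_eq_zero_of_mem_rootSpace hx (mem_rootSpace_zero h)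
    fun h0 => root_ne_zero α (by rw [← neg_neg (α.1 : H → ℂ), ← h0, neg_zero])

lemma weightProj_eq_self {S : Set (LieModule.Weight ℂ H L)} {χ : H → ℂ} {y : L}
    (hy : y ∈ rootSpace H χ) (hS : ∀ ψ : LieModule.Weight ℂ H L, (ψ : H → ℂ) = χ → ψ ∈ S) :
    weightProj H S y = y :=
  Submodule.projection_apply_of_mem_left _ (mem_weightSum hy hS)

lemma weightProj_eq_zero {S : Set (LieModule.Weight ℂ H L)} {χ : H → ℂ} {y : L}
    (hy : y ∈ rootSpace H χ) (hS : ∀ ψ : LieModule.Weight ℂ H L, (ψ : H → ℂ) = χ → ψ ∉ S) :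
    weightProj H S y = 0 :=
  Submodule.projection_apply_of_mem_right _ (mem_weightSum hy hS)

lemma killingForm_eq_zero_of_mem_weightSum {S : Set (LieModule.Weight ℂ H L)} {χ : H → ℂ} {u y : L}
    (hu : u ∈ rootSpace H χ) (hS : ∀ ψ ∈ S, (ψ : H → ℂ) ≠ -χ) (hy : y ∈ weightSum H S) :
    killingForm ℂ L u y = 0 := by
  have : weightSum H S ≤ LinearMap.ker (killingForm ℂ L u) :=
    iSup₂_le fun ψ hψ z hz => killingForm_eq_zero_of_mem_rootSpace hu hz (hS ψ hψ)
  exact this hy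

lemma killingForm_weightProj_eq_zero {S : Set (LieModule.Weight ℂ H L)} {χ : H → ℂ} {u : L}
    (hu : u ∈ rootSpace H χ) (hS : ∀ ψ ∈ S, (ψ : H → ℂ) ≠ -χ) (y : L) :
    killingForm ℂ L u (weightProj H S y) = 0 :=
  killingForm_eq_zero_of_mem_weightSum hu hS (Submodule.projection_apply_mem _ y)

/-- `u` pairs only with the weight space of `-χ`, so the component of `y` outside `S` is invisible
to it. This computes Killing adjoints of the projections. -/
lemma killingForm_weightProj_eq {S : Set (LieModule.Weight ℂ H L)} {χ : H → ℂ} {u : L}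
    (hu : u ∈ rootSpace H χ) (hS : ∀ ψ : LieModule.Weight ℂ H L, (ψ : H → ℂ) = -χ → ψ ∈ S)
    (y : L) : killingForm ℂ L u (weightProj H S y) = killingForm ℂ L u y := by
  have h : y - weightProj H S y ∈ weightSum H Sᶜ := by
    have := (Submodule.ker_projection (isCompl_weightSum H S)).le
    refine this ?_
    have hid := Submodule.projection_apply_of_mem_left (isCompl_weightSum H S)
      (Submodule.projection_apply_mem (isCompl_weightSum H S) y)
    rw [LinearMap.mem_ker, map_sub, sub_eq_zero]
    exact hid.symm
  have h2 := killingForm_eq_zero_of_mem_weightSum hu (S := Sᶜ)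
    (fun ψ hψ h' => hψ (hS ψ h')) h
  rw [map_sub, sub_eq_zero] at h2
  exact h2.symm

variable [IsKilling ℂ L]


lemma killingForm_cartanEquivDual_symm (f : Module.Dual ℂ H) (h : H) :
    killingForm ℂ L ((cartanEquivDual H).symm f : L) h = f h :=
  LinearMap.BilinForm.apply_toDual_symm_apply (hB := traceForm_cartan_nondegenerate ℂ L H) f h

lemma negRoot_negRoot (α : H.root) : negRoot (negRoot α) = α :=
  Subtype.ext (neg_neg α.1)

lemma negRoot_injective : Function.Injective (negRoot (H := H)) :=
  Function.LeftInverse.injective negRoot_negRoot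

lemma negRoot_apply (α : H.root) (h : H) : (negRoot α).1 h = -α.1 h := rfl

lemma IsCartanWeyl.lie {e : H.root → L} (he : IsCartanWeyl e) (h : H) (α : H.root) :
    ⁅(h : L), e α⁆ = α.1 h • e α :=
  lie_eq_smul_of_mem_rootSpace (he.mem α) h

lemma IsCartanWeyl.killingForm [DecidableEq H.root] {e : H.root → L} (he : IsCartanWeyl e)
    (α α' : H.root) : killingForm ℂ L (e (negRoot α)) (e α') = if α = α' then 1 else 0 := by
  split_ifs with h
  · rw [← h, killingForm_comm, he.norm]
  · refine killingForm_eq_zero_of_mem_rootSpace (he.mem _) (he.mem _) fun h' => h ?_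
    refine Subtype.ext (LieModule.Weight.ext fun z => ?_)
    have := congrFun h' z
    rw [this, Pi.neg_apply, negRoot_apply, neg_neg]

variable (b : (rootSystem H).Base)

lemma rootVec_eq_smul_coroot (α : H.root) :
    rootVec α = (α.1 (rootVec α) / 2) • (rootSystem H).coroot α := by
  have h0 : α.1 (rootVec α) ≠ 0 :=
    root_apply_cartanEquivDual_symm_ne_zero (LieSubalgebra.isNonZero_coe_root α)
  have h : (rootSystem H).coroot α = (2 : ℕ) • (α.1 (rootVec α))⁻¹ • rootVec α := rfl
  rw [h, ← Nat.cast_smul_eq_nsmul ℂ, smul_smul, smul_smul]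
  have : α.1 (rootVec α) / 2 * (((2 : ℕ) : ℂ) * (α.1 (rootVec α))⁻¹) = 1 := by
    push_cast
    field_simp
  rw [← mul_assoc] at this
  rw [this, one_smul]

lemma killingForm_rootVec (α : H.root) (h : H) :
    killingForm ℂ L (rootVec α : L) h = α.1 h :=
  killingForm_cartanEquivDual_symm _ h

lemma rootVec_simple (i : b.support) :
    rootVec (i : H.root) = dSimple b i • (rootSystem H).coroot (i : H.root) := by
  rw [dSimple, killingForm_rootVec]
  exact rootVec_eq_smul_coroot _

/-- An element of the Cartan subalgebra measuring heights. -/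
lemma exists_height_element : ∃ h : H, (∀ i : b.support, (i : H.root).1 h = 1) ∧
    ∀ α : H.root, b.IsPos α → ∃ m : ℕ, 1 ≤ m ∧ α.1 h = m := by
  -- The functional on the dual of `H` equal to `1` on every simple root is evaluation at a point,
  -- the sum of the fundamental coweights.
  let h : H := (Module.evalEquiv ℂ H).symm (b.toWeightBasis.constr ℂ fun _ => (1 : ℂ))
  have h1 : ∀ i : b.support, (rootSystem H).root (i : H.root) h = 1 := fun i => by
    rw [Module.apply_evalEquiv_symm_apply, ← b.toWeightBasis_apply, Module.Basis.constr_basis]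
  refine ⟨h, h1, fun α hα => ?_⟩
  obtain ⟨f, -, -, hf⟩ := b.exists_root_eq_sum_int α
  have h2 := RootPairing.Base.height_eq_sum hf
  have h3 : α.1 h = ((b.height α : ℤ) : ℂ) := by
    have := congrArg (fun φ : Module.Dual ℂ H => φ h) hf
    simp only [LinearMap.sum_apply, LinearMap.smul_apply] at this
    rw [h2]
    refine Eq.trans this ?_
    rw [Int.cast_sum]
    refine Finset.sum_congr rfl fun j hj => ?_
    rw [h1 ⟨j, hj⟩]
    simp
  have h4 : 0 < b.height α := hα
  refine ⟨(b.height α).toNat, by omega, ?_⟩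
  rw [h3]
  exact_mod_cast (Int.toNat_of_nonneg h4.le).symm

/-! #### The operator `R + c` -/

lemma mem_posWeights_of_eq {α : H.root} (hα : b.IsPos α) {ψ : LieModule.Weight ℂ H L}
    (h : (ψ : H → ℂ) = α.1) : ψ ∈ posWeights b :=
  ⟨α, hα, LieModule.Weight.ext (congrFun h)⟩

lemma notMem_negWeights_of_eq {α : H.root} (hα : b.IsPos α) {ψ : LieModule.Weight ℂ H L}
    (h : (ψ : H → ℂ) = α.1) : ψ ∉ negWeights b := by
  rintro ⟨α', hα', rfl⟩
  obtain ⟨g, -, hg⟩ := exists_height_element b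
  obtain ⟨m, hm, h1⟩ := hg α hα
  obtain ⟨m', hm', h2⟩ := hg α' hα'
  have h3 := congrFun h g
  rw [negRoot_apply, h1, h2] at h3
  have h4 : ((m + m' : ℕ) : ℂ) = 0 := by
    push_cast
    linear_combination -h3
  have := Nat.cast_eq_zero.mp h4
  omega

lemma notMem_posWeights_of_eq_zero {ψ : LieModule.Weight ℂ H L} (h : (ψ : H → ℂ) = 0) :
    ψ ∉ posWeights b := by
  rintro ⟨α, -, rfl⟩
  exact root_ne_zero α h

lemma notMem_negWeights_of_eq_zero {ψ : LieModule.Weight ℂ H L} (h : (ψ : H → ℂ) = 0) :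
    ψ ∉ negWeights b := by
  rintro ⟨α, -, rfl⟩
  exact root_ne_zero _ h

variable (c : ℂ)

lemma standardR_add_apply_cartan (h : H) :
    (standardR b c + c • LinearMap.id : L →ₗ[ℂ] L) (h : L) = c • (h : L) := by
  simp [standardR, weightProj_eq_zero (mem_rootSpace_zero h)
    fun _ => notMem_posWeights_of_eq_zero b, weightProj_eq_zero (mem_rootSpace_zero h)
    fun _ => notMem_negWeights_of_eq_zero b]

lemma standardR_add_apply_pos {α : H.root} (hα : b.IsPos α) {y : L} (hy : y ∈ rootSpace H α.1) :
    (standardR b c + c • LinearMap.id : L →ₗ[ℂ] L) y = (2 * c) • y := by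
  simp only [standardR, LinearMap.add_apply, LinearMap.smul_apply, LinearMap.sub_apply,
    LinearMap.id_apply, weightProj_eq_self hy fun _ => mem_posWeights_of_eq b hα,
    weightProj_eq_zero hy fun _ => notMem_negWeights_of_eq b hα]
  module

lemma killingForm_standardR_add_cartan (h : H) (y : L) :
    killingForm ℂ L (c • (h : L)) y =
      killingForm ℂ L (h : L) ((standardR b c + c • LinearMap.id : L →ₗ[ℂ] L) y) := by
  simp [standardR, killingForm_weightProj_eq_zero (mem_rootSpace_zero h)
    (fun ψ hψ h0 => notMem_posWeights_of_eq_zero b (by rw [h0, neg_zero]) hψ),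
    killingForm_weightProj_eq_zero (mem_rootSpace_zero h)
    (fun ψ hψ h0 => notMem_negWeights_of_eq_zero b (by rw [h0, neg_zero]) hψ)]

lemma killingForm_standardR_add_neg {α : H.root} (hα : b.IsPos α) {u : L}
    (hu : u ∈ rootSpace H (negRoot α).1) (y : L) :
    killingForm ℂ L ((2 * c) • u) y =
      killingForm ℂ L u ((standardR b c + c • LinearMap.id : L →ₗ[ℂ] L) y) := by
  have hn : -((negRoot α).1 : H → ℂ) = α.1 := by
    funext z
    rw [Pi.neg_apply, negRoot_apply, neg_neg]
  have h1 := killingForm_weightProj_eq (S := posWeights b) hu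
    (fun ψ h => mem_posWeights_of_eq b hα (h.trans hn)) y
  have h2 := killingForm_weightProj_eq_zero (S := negWeights b) hu
    (fun ψ hψ h => notMem_negWeights_of_eq b hα (h.trans hn) hψ) y
  simp only [standardR, LinearMap.add_apply, LinearMap.smul_apply, LinearMap.sub_apply,
    LinearMap.id_apply, map_add, map_sub, map_smul, h1, h2, smul_eq_mul]
  ring

/-! #### Fundamental coweights -/

variable [DecidableEq b.support]

lemma killingForm_coroot_fundP (i k : b.support) :
    killingForm ℂ L ((rootSystem H).coroot (i : H.root) : L) (fundP b k) =
      if i = k then 1 else 0 := by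
  rw [killingForm_comm, fundP, killingForm_cartanEquivDual_symm, Module.Basis.coord_apply,
    b.toCoweightBasis_repr_coroot, Finsupp.single_apply]

/-- `α_j` is pairing with `H_j = d_j α_j^∨`, and the `P_i` are `κ`-dual to the coroots. -/
lemma root_fundP (j i : b.support) :
    (j : H.root).1 (fundP b i) = if j = i then dSimple b j else 0 := by
  rw [← killingForm_rootVec, rootVec_simple]
  have := killingForm_coroot_fundP b j i
  rw [show ((dSimple b j • (rootSystem H).coroot (j : H.root) : H) : L) =
      dSimple b j • ((rootSystem H).coroot (j : H.root) : L) from rfl, map_smul,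
    LinearMap.smul_apply, this]
  simp

end Roots

/-! ### Reading off the charges from a Gauss factor -/

section Charges

open LieAlgebra LieAlgebra.IsKilling

variable {E : Type*} [NormedAddCommGroup E] [NormedSpace ℝ E]
  {X : Type*} [TopologicalSpace X] {I : ModelWithCorners ℝ E X}
  {M : Type*} [TopologicalSpace M] [ChartedSpace X M]

lemma IsPointDerivation.const_mul {x : M} {δ : SmoothC I M →+ ℂ} (hδ : IsPointDerivation x δ)
    (z : ℂ) (f : SmoothC I M) : δ (SmoothC.const z * f) = z * δ f := by
  rw [hδ.mul, hδ.const, zero_mul, zero_add, SmoothC.const_apply]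

variable {L : Type*} [LieRing L] [LieAlgebra ℂ L] [FiniteDimensional ℂ L] [IsKilling ℂ L]
  {H : LieSubalgebra ℂ L} [H.IsCartanSubalgebra] (b : (rootSystem H).Base)

/-- The exponents `ε A_{β_k} Q_{β_k} E_{β_k}` of an ordered product. -/
def rootExponents {N : ℕ} (β : Fin N → H.root) (e : H.root → L) (A : H.root → ℂ) (ε : ℂ)
    (QE : H.root → SmoothC I M) : List (SmoothC I M × L) :=
  List.ofFn fun k => (SmoothC.const (ε * A (β k)) * QE (β k), e (β k))

/-- The element `∑ ε Q^H_i P_i` of the Cartan subalgebra at a point. -/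
def cartanExponent (ε : ℂ) (QH : b.support → SmoothC I M) (x : M) : H :=
  ∑ i, (ε * QH i x) • fundP b i

lemma coe_cartanExponent (ε : ℂ) (QH : b.support → SmoothC I M) (x : M) :
    (cartanExponent b ε QH x : L) =
      ∑ i, (SmoothC.const ε * QH i : SmoothC I M) x • (fundP b i : L) := by
  rw [cartanExponent, AddSubmonoidClass.coe_finsetSum]
  rfl

lemma root_cartanExponent (ε : ℂ) (QH : b.support → SmoothC I M) (x : M)
    (j : b.support) : (j : H.root).1 (cartanExponent b ε QH x) = ε * (dSimple b j * QH j x) := by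
  classical
  have h : (j : H.root).1 (cartanExponent b ε QH x) =
      (rootSystem H).root (j : H.root) (cartanExponent b ε QH x) := rfl
  rw [h, cartanExponent, map_sum]
  simp only [map_smul, rootSystem_root_apply, LieModule.Weight.toLinear_apply, root_fundP,
    smul_eq_mul, mul_ite, mul_zero,
    Finset.sum_ite_eq, Finset.mem_univ, if_true]
  ring

lemma cartan_lie_eq_zero (h h' : H) : ⁅(h : L), (h' : L)⁆ = 0 := by
  have : ⁅h, h'⁆ = 0 := LieModule.IsTrivial.trivial h h'
  exact congrArg ((↑) : H → L) this

variable {b} {n : Type*} [Fintype n] [DecidableEq n] {ρ : L →ₗ⁅ℂ⁆ Matrix n n ℂ}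
  {s : Matrix n n ℂ →ₗ[ℂ] L} (hs : ∀ y, s (ρ y) = y)
  {e : H.root → L} (he : IsCartanWeyl e) {N : ℕ} {β : Fin N → H.root}
  {g : H} (hg : ∀ k, ∃ m : ℕ, 1 ≤ m ∧ (β k).1 g = m)
  {A : H.root → ℂ} {ε : ℂ} {QH : b.support → SmoothC I M} {QE : H.root → SmoothC I M}
  {l : List (SmoothC I M × L)} (hl : l.Perm (rootExponents β e A ε QE)) {x : M}

include he hg

lemma IsCartanWeyl.mem_heightStep_one (k : Fin N) : e (β k) ∈ heightStep (g : L) 1 := by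
  obtain ⟨m, hm, h⟩ := hg k
  exact mem_heightStep hm (by rw [he.lie, h])

include hl

lemma mem_heightStep_of_mem_exponents : ∀ p ∈ l, p.2 ∈ heightStep (g : L) 1 := by
  intro p hp
  obtain ⟨k, rfl⟩ := (List.mem_ofFn' _ _).mp (hl.mem_iff.mp hp)
  exact he.mem_heightStep_one hg k

-- Only the underlying family of exponents matters, so the reversed product coming from `Γ⁻` needs
-- no separate treatment.
omit he hg [IsKilling ℂ L] in
lemma sum_map_exponents {V : Type*} [AddCommMonoid V] (F : SmoothC I M × L → V) :
    (l.map F).sum = ∑ k, F (SmoothC.const (ε * A (β k)) * QE (β k), e (β k)) := by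
  rw [(hl.map F).sum_eq, rootExponents, List.map_ofFn, List.sum_ofFn]
  rfl

/-- A Gauss factor with Cartan part `exp (∑ ε Q^H_i P_i)`. -/
abbrev chargeProd (ρ : L →ₗ⁅ℂ⁆ Matrix n n ℂ) (l : List (SmoothC I M × L)) (ε : ℂ)
    (QH : b.support → SmoothC I M) : M → Matrix n n ℂ :=
  gaussProd ρ l (fun i => SmoothC.const ε * QH i) fun i => (fundP b i : L)

omit hg hl in
lemma IsCartanWeyl.neg_lie_cartanExponent (α : H.root) :
    ⁅e (negRoot α), ∑ i, (SmoothC.const ε * QH i : SmoothC I M) x • (fundP b i : L)⁆ =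
      α.1 (cartanExponent b ε QH x) • e (negRoot α) := by
  rw [← coe_cartanExponent, ← lie_skew, he.lie, negRoot_apply, neg_smul, neg_neg]

omit hg hl in
lemma IsCartanWeyl.neg_lie_height {α : H.root} (hα : α.1 g = 1) :
    ⁅(g : L), e (negRoot α)⁆ = -((1 : ℕ) : ℂ) • e (negRoot α) := by
  rw [he.lie, negRoot_apply, hα, Nat.cast_one]

include hs

lemma exists_hasMatrixDeriv_chargeProd_root (hβ : Function.Injective β) {k : Fin N}
    (hα : (β k).1 g = 1) {δ : SmoothC I M →+ ℂ} (hδ : IsPointDerivation x δ) :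
    ∃ C, HasMatrixDeriv δ (chargeProd ρ l ε QH) C ∧
      killingForm ℂ L (e (negRoot (β k))) (s ((chargeProd ρ l ε QH x)⁻¹ * C)) =
        Complex.exp (-(β k).1 (cartanExponent b ε QH x)) * (ε * A (β k)) * δ (QE (β k)) := by
  classical
  obtain ⟨C, h1, h2⟩ := exists_hasMatrixDeriv_gaussProd hs
    (mem_heightStep_of_mem_exponents he hg hl) (fun i k => cartan_lie_eq_zero _ _)
    (he.neg_lie_cartanExponent (QH := QH) (ε := ε) (x := x) (β k)) (he.neg_lie_height hα)
    one_lt_two hδ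
  refine ⟨C, h1, h2.trans ?_⟩
  simp only [sum_map_exponents hl, he.killingForm, hβ.eq_iff,
    killingForm_cartan_of_mem_rootSpace (he.mem _), hδ.const_mul, mul_ite, mul_one, mul_zero,
    Finset.sum_ite_eq, Finset.mem_univ, if_true, Finset.sum_const_zero, add_zero]
  ring

/-- To first order `h` becomes `h + ∑ ε A Q^E_β β(h) E_β`, of which `E_{-α}` sees only the `α`
coefficient. -/
lemma chargeProd_conj_cartan_root (hβ : Function.Injective β) {k : Fin N}
    (hα : (β k).1 g = 1) (h : H) :
    killingForm ℂ L (e (negRoot (β k)))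
        (s ((chargeProd ρ l ε QH x)⁻¹ * ρ h * chargeProd ρ l ε QH x)) =
      Complex.exp (-(β k).1 (cartanExponent b ε QH x)) * (ε * A (β k)) *
        (QE (β k) x * (β k).1 h) := by
  classical
  have hb : (h : L) ∈ heightStep (g : L) 0 :=
    mem_heightStep (m := 0) le_rfl (by rw [cartan_lie_eq_zero, Nat.cast_zero, zero_smul])
  rw [killingForm_gaussProd_conj hs (mem_heightStep_of_mem_exponents he hg hl)
    (he.neg_lie_cartanExponent (QH := QH) (ε := ε) (x := x) (β k)) (he.neg_lie_height hα)
    one_lt_two hb]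
  simp only [sum_map_exponents hl, he.lie, map_smul, he.killingForm, hβ.eq_iff,
    killingForm_cartan_of_mem_rootSpace (he.mem _), smul_eq_mul, mul_ite, mul_one, mul_zero,
    Finset.sum_ite_eq, Finset.mem_univ, if_true, zero_add, ContMDiffMap.coe_mul, Pi.mul_apply,
    SmoothC.const_apply]
  ring

/-- The first-order brackets `⁅e (β k'), e (β j)⁆` already have height at least `2`, so only the
undeformed pairing remains. -/
lemma chargeProd_conj_root_root [DecidableEq H.root] {k : Fin N} (hα : (β k).1 g = 1)
    (k' : Fin N) :
    killingForm ℂ L (e (negRoot (β k)))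
        (s ((chargeProd ρ l ε QH x)⁻¹ * ρ (e (β k')) * chargeProd ρ l ε QH x)) =
      Complex.exp (-(β k).1 (cartanExponent b ε QH x)) * if β k = β k' then 1 else 0 := by
  have hb := he.mem_heightStep_one hg k'
  have hb0 : e (β k') ∈ heightStep (g : L) 0 := heightStep_antitone (g : L) (Nat.zero_le 1) hb
  have h2 : ∀ j, killingForm ℂ L (e (negRoot (β k))) ⁅e (β k'), e (β j)⁆ = 0 := fun j =>
    killingForm_eq_zero_of_mem_heightStep (k := 1 + 1) (he.neg_lie_height hα) (by norm_num)
      (lie_mem_heightStep hb (he.mem_heightStep_one hg j))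
  rw [killingForm_gaussProd_conj hs (mem_heightStep_of_mem_exponents he hg hl)
    (he.neg_lie_cartanExponent (QH := QH) (ε := ε) (x := x) (β k)) (he.neg_lie_height hα)
    one_lt_two hb0, he.killingForm, sum_map_exponents hl]
  simp only [h2, mul_zero, Finset.sum_const_zero, add_zero]

omit he hg hl hs in
lemma cartan_lie_cartanExponent (h : H) :
    ⁅(h : L), ∑ i, (SmoothC.const ε * QH i : SmoothC I M) x • (fundP b i : L)⁆ =
      (0 : ℂ) • (h : L) := by
  rw [← coe_cartanExponent, cartan_lie_eq_zero, zero_smul]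

omit he hg hl hs in
lemma cartan_lie_height (g h : H) : ⁅(g : L), (h : L)⁆ = -((0 : ℕ) : ℂ) • (h : L) := by
  rw [cartan_lie_eq_zero, Nat.cast_zero, neg_zero, zero_smul]

lemma exists_hasMatrixDeriv_chargeProd_cartan [DecidableEq b.support] (i : b.support)
    {δ : SmoothC I M →+ ℂ} (hδ : IsPointDerivation x δ) :
    ∃ C, HasMatrixDeriv δ (chargeProd ρ l ε QH) C ∧
      killingForm ℂ L ((rootSystem H).coroot (i : H.root) : L)
        (s ((chargeProd ρ l ε QH x)⁻¹ * C)) = ε * δ (QH i) := by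
  obtain ⟨C, h1, h2⟩ := exists_hasMatrixDeriv_gaussProd hs
    (mem_heightStep_of_mem_exponents he hg hl) (fun i k => cartan_lie_eq_zero _ _)
    (cartan_lie_cartanExponent (QH := QH) (ε := ε) (x := x) _) (cartan_lie_height g _)
    two_pos hδ
  refine ⟨C, h1, h2.trans ?_⟩
  have h0 : ∀ α, killingForm ℂ L ((rootSystem H).coroot (i : H.root) : L) (e α) = 0 := fun α => by
    rw [killingForm_comm, killingForm_cartan_of_mem_rootSpace (he.mem _)]
  simp only [sum_map_exponents hl, h0, killingForm_coroot_fundP, hδ.const_mul, mul_ite, mul_one,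
    mul_zero, Finset.sum_ite_eq, Finset.mem_univ, if_true, Finset.sum_const_zero, zero_add]

lemma chargeProd_conj_cartan_cartan (h h' : H) :
    killingForm ℂ L (h : L) (s ((chargeProd ρ l ε QH x)⁻¹ * ρ h' * chargeProd ρ l ε QH x)) =
      killingForm ℂ L (h : L) h' := by
  have hb : (h' : L) ∈ heightStep (g : L) 0 :=
    mem_heightStep (m := 0) le_rfl (by rw [cartan_lie_eq_zero, Nat.cast_zero, zero_smul])
  rw [killingForm_gaussProd_conj hs (mem_heightStep_of_mem_exponents he hg hl)
    (cartan_lie_cartanExponent (QH := QH) (ε := ε) (x := x) _) (cartan_lie_height g _)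
    two_pos hb]
  have h0 : ∀ α, killingForm ℂ L (h : L) (e α) = 0 := fun α => by
    rw [killingForm_comm, killingForm_cartan_of_mem_rootSpace (he.mem _)]
  simp [sum_map_exponents hl, he.lie, h0]

lemma chargeProd_conj_root_cartan (h : H) (k : Fin N) :
    killingForm ℂ L (h : L)
        (s ((chargeProd ρ l ε QH x)⁻¹ * ρ (e (β k)) * chargeProd ρ l ε QH x)) = 0 := by
  have hb := he.mem_heightStep_one hg k
  have hb0 : e (β k) ∈ heightStep (g : L) 0 := heightStep_antitone (g : L) (Nat.zero_le 1) hb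
  have h1 : killingForm ℂ L (h : L) (e (β k)) = 0 := by
    rw [killingForm_comm, killingForm_cartan_of_mem_rootSpace (he.mem _)]
  have h2 : ∀ j, killingForm ℂ L (h : L) ⁅e (β k), e (β j)⁆ = 0 := fun j =>
    killingForm_eq_zero_of_mem_heightStep (k := 1 + 1) (cartan_lie_height (g : H) h) (by norm_num)
      (lie_mem_heightStep hb (he.mem_heightStep_one hg j))
  rw [killingForm_gaussProd_conj hs (mem_heightStep_of_mem_exponents he hg hl)
    (cartan_lie_cartanExponent (QH := QH) (ε := ε) (x := x) _) (cartan_lie_height g _)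
    two_pos hb0, sum_map_exponents hl, h1]
  simp only [h2, mul_zero, Finset.sum_const_zero, add_zero]

end Charges

/-! ### The brackets of the charges -/

section Main

open LieAlgebra LieAlgebra.IsKilling

variable {E : Type*} [NormedAddCommGroup E] [NormedSpace ℝ E]
  {X : Type*} [TopologicalSpace X] {I : ModelWithCorners ℝ E X}
  {M : Type*} [TopologicalSpace M] [ChartedSpace X M]
  {n : Type*} [Fintype n] [DecidableEq n]
  {L : Type*} [LieRing L] [LieAlgebra ℂ L] [FiniteDimensional ℂ L]
  {ρ : L →ₗ⁅ℂ⁆ Matrix n n ℂ}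

/-- The mixed quadratic bracket of `G` and `G'⁻¹`, paired through the Killing form. -/
lemma QuadraticPB.killing_contract [IsKilling ℂ L] {P : PoissonStructure I M} {γ : ℝ}
    {T : L →ₗ[ℂ] L} {Γ Γ' : Matrix n n (SmoothC I M)}
    (h : QuadraticPB ρ P γ (killingKernel T) Γ Γ') {s : Matrix n n ℂ →ₗ[ℂ] L}
    (hs : ∀ y, s (ρ y) = y) {G G' : M → Matrix n n ℂ} (hG : ∀ y, matrixEval Γ y = G y)
    (hG' : ∀ y, matrixEval Γ' y = (G' y)⁻¹) (hGu : ∀ y, IsUnit (G y)) (hGu' : ∀ y, IsUnit (G' y))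
    {x : M} {U W Y : L} {t t' : ℂ} {p q : SmoothC I M}
    (ht : ∀ δ, IsPointDerivation x δ → ∃ C, HasMatrixDeriv δ G C ∧
      killingForm ℂ L U (s ((G x)⁻¹ * C)) = t * δ p)
    (ht' : ∀ δ, IsPointDerivation x δ → ∃ C, HasMatrixDeriv δ G' C ∧
      killingForm ℂ L Y (s ((G' x)⁻¹ * C)) = t' * δ q)
    (hW : ∀ Y, killingForm ℂ L W Y = killingForm ℂ L U (T Y)) :
    -(t * t') * P.pb p q x = γ * (killingForm ℂ L U (s ((G x)⁻¹ * ρ (T Y) * G x)) -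
      killingForm ℂ L Y (s ((G' x)⁻¹ * ρ W * G' x))) := by
  have hu := (Matrix.isUnit_iff_isUnit_det _).mp (hGu x)
  have hu' : ∀ y, IsUnit (G' y).det := fun y => (Matrix.isUnit_iff_isUnit_det _).mp (hGu' y)
  -- These translations cancel `Γ = G` and `Γ' = G'⁻¹`, so `Φ (G ρ(a)) = κ(U, a)` and `Ψ (ρ(b) G'⁻¹)
  -- = κ(b, Y)`. The sign of `t'` comes from differentiating an inverse.
  have key := h.contract x
    (killingForm ℂ L U ∘ₗ s ∘ₗ LinearMap.mulLeft ℂ (G x)⁻¹)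
    (killingForm ℂ L Y ∘ₗ s ∘ₗ LinearMap.mulRight ℂ (G' x))
    (p := p) (q := q) (t := t) (t' := -t') (U := U) (W := W) (Y := Y) ?_ ?_ ?_ ?_ hW
  · simp only [LinearMap.comp_apply, LinearMap.mulLeft_apply, LinearMap.mulRight_apply, hG, hG',
      ← mul_assoc] at key
    rw [← key]
    ring
  · intro δ hδ
    obtain ⟨C, h1, h2⟩ := ht δ hδ
    rw [h1.map_eq Γ hG]
    exact h2
  · intro δ hδ
    obtain ⟨C, h1, h2⟩ := ht' δ hδ
    -- Differentiating `G'⁻¹ G' = 1` gives `δ(G'⁻¹) G' = -G'⁻¹ δG'`.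
    have h3 : HasMatrixDeriv δ (fun y => matrixEval Γ' y * G' y)
        (Γ'.map δ * G' x + matrixEval Γ' x * C) := HasMatrixDeriv.mul hδ ⟨Γ', fun _ => rfl, rfl⟩ h1
    have h4 : (fun y => matrixEval Γ' y * G' y) = fun _ => 1 := funext fun y => by
      rw [hG', Matrix.nonsing_inv_mul _ (hu' y)]
    rw [h4] at h3
    have h5 := h3.unique (HasMatrixDeriv.const hδ 1)
    rw [hG'] at h5
    simp only [LinearMap.comp_apply, LinearMap.mulRight_apply, eq_neg_of_add_eq_zero_left h5,
      map_neg, h2, neg_mul]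
  · intro a
    simp only [LinearMap.comp_apply, LinearMap.mulLeft_apply, hG]
    rw [Matrix.nonsing_inv_mul_cancel_left _ _ hu, hs]
  · intro a
    simp only [LinearMap.comp_apply, LinearMap.mulRight_apply, hG']
    rw [Matrix.nonsing_inv_mul_cancel_right _ _ (hu' x), hs, killingForm_comm]

variable {H : LieSubalgebra ℂ L} [H.IsCartanSubalgebra] [IsKilling ℂ L]
  {b : (rootSystem H).Base}

lemma map_cartanZ (c : ℂ) (γ : ℝ) (QH : b.support → SmoothC I M) (y : M) :
    cartanZ b c γ (fun i => QH i y) = ∑ i,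
      (SmoothC.const (Complex.I * c * γ) * QH i : SmoothC I M) y • (fundP b i : L) := by
  rw [cartanZ, Finset.smul_sum]
  refine Finset.sum_congr rfl fun i _ => ?_
  rw [smul_smul]
  rfl

lemma unipotentPlus_mul_cartanD (e : H.root → L) (A : H.root → ℂ) {N : ℕ} (β : Fin N → H.root)
    (c : ℂ) (γ : ℝ) (QH : b.support → SmoothC I M) (QE : H.root → SmoothC I M) (y : M) :
    unipotentPlus ρ e A β c γ (fun α => QE α y) * cartanD b ρ c γ (fun i => QH i y) =
      chargeProd ρ (rootExponents β e A (Complex.I * c * γ) QE) (Complex.I * c * γ) QH y := by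
  rw [chargeProd, gaussProd, cartanD, map_cartanZ]
  congr 1
  simp [unipotentPlus, expProd, exponentsAt, repExponents, rootExponents, List.map_ofFn,
    Function.comp_def]

/-- `D⁻¹ M⁻ = ((M⁻)⁻¹ D)⁻¹`: inverting `M⁻` reverses its factors and removes the minus signs, so
`Γ⁻` is the inverse of a factor of the same shape as `Γ⁺`. -/
lemma cartanDInv_mul_unipotentMinus (e : H.root → L) (A : H.root → ℂ) {N : ℕ}
    (β : Fin N → H.root) (c : ℂ) (γ : ℝ) (QH : b.support → SmoothC I M)
    (QE : H.root → SmoothC I M) (y : M) :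
    cartanDInv b ρ c γ (fun i => QH i y) * unipotentMinus ρ e A β c γ (fun α => QE α y) =
      (chargeProd ρ (rootExponents (fun k => negRoot (β k)) e A (Complex.I * c * γ) QE).reverse
        (Complex.I * c * γ) QH y)⁻¹ := by
  rw [chargeProd, gaussProd, cartanDInv, map_cartanZ, Matrix.mul_inv_rev, ← Matrix.exp_neg,
    expProd_inv]
  congr 1
  simp [unipotentMinus, expProd, exponentsAt, repExponents, rootExponents, List.map_ofFn,
    Function.comp_def, List.map_reverse]

end Main

end

theorem mainTheorem4
    -- a semisimple complex Lie algebra, a Cartan subalgebra, simple roots, root vectors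
    {L : Type*} [LieRing L] [LieAlgebra ℂ L] [FiniteDimensional ℂ L]
    [LieAlgebra.IsSemisimple ℂ L]
    (H : LieSubalgebra ℂ L) [H.IsCartanSubalgebra]
    (b : (LieAlgebra.IsKilling.rootSystem H).Base) [DecidableEq b.support]
    (e : H.root → L) (he : IsCartanWeyl e)
    -- an admissible ordering of the positive roots
    {N : ℕ} (β : Fin N → H.root) (hβ : IsConvexOrder b β)
    -- a faithful matrix representation
    {n : Type*} [Fintype n] [DecidableEq n]
    (ρ : L →ₗ⁅ℂ⁆ Matrix n n ℂ) (hρ : Function.Injective ρ)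
    -- a Poisson manifold
    {E : Type*} [NormedAddCommGroup E] [NormedSpace ℝ E]
    {X : Type*} [TopologicalSpace X] (I : ModelWithCorners ℝ E X)
    {M : Type*} [TopologicalSpace M] [ChartedSpace X M] [IsManifold I ∞ M]
    (P : PoissonStructure I M)
    -- the split case `c = 1` and the non-split case `c = i`
    (c : ℂ) (hc : c = 1 ∨ c = Complex.I) (γ : ℝ) (hγ : γ ≠ 0)
    -- the normalisation constants and the charges
    (A : H.root → ℂ) (hA : ∀ α, A α ≠ 0)
    (QH : b.support → SmoothC I M) (QE : H.root → SmoothC I M)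
    -- `Γ⁺ = M⁺ D` and `Γ⁻ = D⁻¹ M⁻`
    (Γp Γm : Matrix n n (SmoothC I M))
    (hΓp : ∀ x, matrixEval Γp x =
      unipotentPlus ρ e A β c γ (fun α => QE α x) * cartanD b ρ c γ (fun i => QH i x))
    (hΓm : ∀ x, matrixEval Γm x =
      cartanDInv b ρ c γ (fun i => QH i x) * unipotentMinus ρ e A β c γ (fun α => QE α x))
    (hSTS : STSBrackets ρ P γ c (standardR b c) Γp Γm) :
    (∀ (i j : b.support) (x : M), P.pb (QH i) (QH j) x = 0) ∧
    (∀ (i j : b.support) (x : M),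
      Complex.I * P.pb (QH i) (QE j) x = cartanEntry b i j * QE j x ∧
      Complex.I * P.pb (QH i) (QE (negRoot j)) x = -cartanEntry b i j * QE (negRoot j) x) ∧
    ((∀ i : b.support, A (negRoot i) = A i ∧
        A i ^ 2 = 4 * Complex.sinh (Complex.I * c * γ * dSimple b i) / (Complex.I * c * γ)) →
      ∀ (i j : b.support) (x : M),
        Complex.I * P.pb (QE i) (QE (negRoot j)) x =
          if i = j then
            (qPow c γ (dSimple b i * QH i x) - qPow c γ (-(dSimple b i * QH i x))) /
              (qPow c γ (dSimple b i) - qPow c γ (-dSimple b i))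
          else 0) := by
  classical
  set ε : ℂ := Complex.I * c * γ with hε
  have hc0 : c ≠ 0 := by rcases hc with rfl | rfl <;> simp
  have hγ0 : (γ : ℂ) ≠ 0 := by exact_mod_cast hγ
  have hε0 : ε ≠ 0 := mul_ne_zero (mul_ne_zero Complex.I_ne_zero hc0) hγ0
  -- A linear retraction of `ρ` extends Killing pairings to functionals on all matrices.
  obtain ⟨s, hs'⟩ := (ρ : L →ₗ[ℂ] Matrix n n ℂ).exists_leftInverse_of_injective
    (LinearMap.ker_eq_bot.mpr hρ)
  have hs : ∀ y, s (ρ y) = y := fun y => LinearMap.congr_fun hs' y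
  obtain ⟨g, hg1, hgpos⟩ := exists_height_element b
  have hpos : ∀ k, b.IsPos (β k) := fun k => hβ.range_eq.subset ⟨k, rfl⟩
  have hgp : ∀ k, ∃ m : ℕ, 1 ≤ m ∧ (β k).1 g = m := fun k => hgpos _ (hpos k)
  -- For `Γ⁻` the height element is `-g`, on which the negative roots are positive; the computations
  -- for `Γ⁺` then apply verbatim.
  have hgm : ∀ k, ∃ m : ℕ, 1 ≤ m ∧ (negRoot (β k)).1 (-g) = m := fun k => by
    obtain ⟨m, hm, h⟩ := hgp k
    refine ⟨m, hm, ?_⟩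
    rw [negRoot_apply, ← h]
    exact (congrArg Neg.neg ((β k).1.toLinear.map_neg g)).trans (neg_neg _)
  have hsimple : ∀ i : b.support, ∃ k, β k = i := fun i =>
    hβ.range_eq.superset (RootPairing.Base.isPos_of_mem_support i.2)
  choose κ hκ using hsimple
  have hαp : ∀ i, (β (κ i)).1 g = 1 := fun i => by rw [hκ, hg1]
  have hαm : ∀ i, (negRoot (β (κ i))).1 (-g) = 1 := fun i => by
    rw [negRoot_apply, ← hαp i]
    exact (congrArg Neg.neg ((β (κ i)).1.toLinear.map_neg g)).trans (neg_neg _)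
  have hβm : Function.Injective fun k => negRoot (β k) := negRoot_injective.comp hβ.injective
  set lp := rootExponents β e A ε QE with hlp
  set lm := (rootExponents (fun k => negRoot (β k)) e A ε QE).reverse with hlm
  have hlp' : lp.Perm (rootExponents β e A ε QE) := List.Perm.refl _
  have hlm' : lm.Perm (rootExponents (fun k => negRoot (β k)) e A ε QE) := List.reverse_perm _
  have hP : ∀ y, matrixEval Γp y = chargeProd ρ lp ε QH y := fun y =>
    (hΓp y).trans (unipotentPlus_mul_cartanD e A β c γ QH QE y)
  have hM : ∀ y, matrixEval Γm y = (chargeProd ρ lm ε QH y)⁻¹ := fun y =>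
    (hΓm y).trans (cartanDInv_mul_unipotentMinus e A β c γ QH QE y)
  have hTe : ∀ j : b.support, (standardR b c + c • LinearMap.id : L →ₗ[ℂ] L) (e j) =
      (2 * c) • e j := fun j =>
    standardR_add_apply_pos b c (RootPairing.Base.isPos_of_mem_support j.2) (he.mem _)
  have contract := fun (x : M) (U W Y : L) (t t' : ℂ) (p q : SmoothC I M) =>
    hSTS.pm.killing_contract hs hP hM (fun _ => isUnit_gaussProd) (fun _ => isUnit_gaussProd)
      (x := x) (U := U) (W := W) (Y := Y) (t := t) (t' := t') (p := p) (q := q)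
  have hWH := killingForm_standardR_add_cartan b c
  have hWE : ∀ (i : b.support) (y : L), killingForm ℂ L ((2 * c) • e (negRoot i)) y =
      killingForm ℂ L (e (negRoot i)) ((standardR b c + c • LinearMap.id : L →ₗ[ℂ] L) y) :=
    fun i => killingForm_standardR_add_neg b c (RootPairing.Base.isPos_of_mem_support i.2)
      (he.mem _)
  have derivPE := fun (i : b.support) (x : M) (δ) (hδ : IsPointDerivation x δ) =>
    exists_hasMatrixDeriv_chargeProd_root hs he hgp hlp' hβ.injective (hαp i) hδ (QH := QH)
  have derivME := fun (i : b.support) (x : M) (δ) (hδ : IsPointDerivation x δ) =>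
    exists_hasMatrixDeriv_chargeProd_root hs he hgm hlm' hβm (hαm i) hδ (QH := QH)
  have derivPH := fun (i : b.support) (x : M) (δ) (hδ : IsPointDerivation x δ) =>
    exists_hasMatrixDeriv_chargeProd_cartan hs he hgp hlp' i hδ (QH := QH)
  have derivMH := fun (i : b.support) (x : M) (δ) (hδ : IsPointDerivation x δ) =>
    exists_hasMatrixDeriv_chargeProd_cartan hs he hgm hlm' i hδ (QH := QH)
  simp only [negRoot_negRoot, hκ] at derivPE derivME
  refine ⟨?_, ?_, ?_⟩
  · intro i j x
    -- `U = α_i^∨`, `Y = α_j^∨`: both terms on the right equal `c κ(α_i^∨, α_j^∨)` and cancel.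
    have h := contract x _ _ _ _ _ _ _ (derivPH i x) (derivMH j x) (hWH _)
    rw [standardR_add_apply_cartan, map_smul, map_smul, Matrix.mul_smul, Matrix.smul_mul,
      Matrix.mul_smul, Matrix.smul_mul, map_smul, map_smul, map_smul, map_smul,
      chargeProd_conj_cartan_cartan hs he hgp hlp', chargeProd_conj_cartan_cartan hs he hgm hlm',
      killingForm_comm, sub_self, mul_zero] at h
    exact (mul_eq_zero.mp h).resolve_left (neg_ne_zero.mpr (mul_ne_zero hε0 hε0))
  · intro i j x
    constructor
    -- `U = E_{-α_j}`, `Y = α_i^∨`: the second term vanishes (`h2`), and the first carries the same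
    -- exponential and `ε A` as the left side.
    · have h := contract x _ _ _ _ _ _ _ (derivPE j x) (derivMH i x) (hWE j)
      have h1 := chargeProd_conj_cartan_root hs he hgp hlp' hβ.injective (hαp j)
        ((LieAlgebra.IsKilling.rootSystem H).coroot (i : H.root)) (QH := QH) (x := x)
      have h2 := chargeProd_conj_root_cartan hs he hgm hlm'
        ((LieAlgebra.IsKilling.rootSystem H).coroot (i : H.root)) (κ j) (QH := QH) (x := x)
      simp only [hκ] at h1 h2
      rw [standardR_add_apply_cartan, map_smul, map_smul, Matrix.mul_smul, Matrix.smul_mul,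
        Matrix.mul_smul, Matrix.smul_mul, map_smul, map_smul, map_smul, map_smul, h1, h2,
        P.pb_skew] at h
      have hu := Complex.exp_ne_zero (-(j : H.root).1 (cartanExponent b ε QH x))
      have hc1 : cartanEntry b i j =
        (j : H.root).1 ((LieAlgebra.IsKilling.rootSystem H).coroot (i : H.root)) := rfl
      rw [hc1]
      have h3 : (Complex.exp (-(j : H.root).1 (cartanExponent b ε QH x)) * (ε * A j)) *
          ((γ * c) * (Complex.I * P.pb (QH i) (QE j) x)) =
        (Complex.exp (-(j : H.root).1 (cartanExponent b ε QH x)) * (ε * A j)) *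
          ((γ * c) * ((j : H.root).1 ((LieAlgebra.IsKilling.rootSystem H).coroot (i : H.root)) *
            QE j x)) := by
        simp only [smul_eq_mul] at h
        linear_combination h +
          (Complex.exp (-(j : H.root).1 (cartanExponent b ε QH x)) * (ε * A j)) *
            P.pb (QH i) (QE j) x * (-hε)
      exact mul_left_cancel₀ (mul_ne_zero hγ0 hc0)
        (mul_left_cancel₀ (mul_ne_zero hu (mul_ne_zero hε0 (hA _))) h3)
    -- `U = α_i^∨`, `Y = E_{α_j}`: now the first term vanishes.
    · have h := contract x _ _ _ _ _ _ _ (derivPH i x) (derivME j x) (hWH _)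
      have h1 := chargeProd_conj_cartan_root hs he hgm hlm' hβm (hαm j)
        ((LieAlgebra.IsKilling.rootSystem H).coroot (i : H.root)) (QH := QH) (x := x)
      have h2 := chargeProd_conj_root_cartan hs he hgp hlp'
        ((LieAlgebra.IsKilling.rootSystem H).coroot (i : H.root)) (κ j) (QH := QH) (x := x)
      simp only [hκ, negRoot_negRoot] at h1 h2
      rw [hTe, map_smul, map_smul, Matrix.mul_smul, Matrix.smul_mul,
        Matrix.mul_smul, Matrix.smul_mul, map_smul, map_smul, map_smul, map_smul, h1, h2] at h
      have hu := Complex.exp_ne_zero (-(negRoot (j : H.root)).1 (cartanExponent b ε QH x))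
      have hc1 : -cartanEntry b i j =
        (negRoot (j : H.root)).1 ((LieAlgebra.IsKilling.rootSystem H).coroot (i : H.root)) := rfl
      rw [hc1]
      have h3 : (Complex.exp (-(negRoot (j : H.root)).1 (cartanExponent b ε QH x)) *
            (ε * A (negRoot j))) * ((γ * c) * (Complex.I * P.pb (QH i) (QE (negRoot j)) x)) =
        (Complex.exp (-(negRoot (j : H.root)).1 (cartanExponent b ε QH x)) *
            (ε * A (negRoot j))) * ((γ * c) *
          ((negRoot (j : H.root)).1 ((LieAlgebra.IsKilling.rootSystem H).coroot (i : H.root)) *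
            QE (negRoot j) x)) := by
        simp only [smul_eq_mul] at h
        linear_combination -h +
          (Complex.exp (-(negRoot (j : H.root)).1 (cartanExponent b ε QH x)) *
            (ε * A (negRoot j))) * P.pb (QH i) (QE (negRoot j)) x * (-hε)
      exact mul_left_cancel₀ (mul_ne_zero hγ0 hc0)
        (mul_left_cancel₀ (mul_ne_zero hu (mul_ne_zero hε0 (hA _))) h3)
  · intro hA2 i j x
    -- `U = E_{-α_i}`, `Y = E_{α_j}`: the right side is `2cγ δ_ij (exp(-α_i(Z)) - exp(α_i(Z)))` with
    -- `α_i(Z) = ε d_i Q^H_i`.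
    have h := contract x _ _ _ _ _ _ _ (derivPE i x) (derivME j x) (hWE i)
    have h1 := chargeProd_conj_root_root hs he hgp hlp' (hαp i) (κ j) (QH := QH) (x := x)
    have h2 := chargeProd_conj_root_root hs he hgm hlm' (hαm j) (κ i) (QH := QH) (x := x)
    simp only [hκ, negRoot_negRoot, negRoot_injective.eq_iff] at h1 h2
    rw [hTe, map_smul, map_smul, Matrix.mul_smul, Matrix.smul_mul,
      Matrix.mul_smul, Matrix.smul_mul, map_smul, map_smul, map_smul, map_smul, h1, h2,
      negRoot_apply, root_cartanExponent, root_cartanExponent, neg_neg, (hA2 j).1] at h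
    by_cases hij : i = j
    · subst hij
      obtain ⟨-, hAi⟩ := hA2 i
      simp only [if_true, smul_eq_mul, mul_one] at h ⊢
      have e1 : qPow c γ (dSimple b i * QH i x) = Complex.exp (-(ε * (dSimple b i * QH i x))) := by
        rw [qPow, neg_mul]
      have e2 : qPow c γ (-(dSimple b i * QH i x)) =
          Complex.exp (ε * (dSimple b i * QH i x)) := by
        rw [qPow, neg_mul_neg]
      -- The exponential prefactors from `G` and `G'` cancel on the left side.
      have e3 : Complex.exp (-(ε * (dSimple b i * QH i x))) *
          Complex.exp (ε * (dSimple b i * QH i x)) = 1 := by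
        rw [← Complex.exp_add, neg_add_cancel, Complex.exp_zero]
      -- The normalisation is chosen for this: `ε A_i² = 4 sinh(ε d_i)`, and `q = exp(-ε)`, whence
      -- the sign. Since `A_i ≠ 0`, it also shows the denominator is nonzero.
      have e4 : ε * A i ^ 2 = -2 * (qPow c γ (dSimple b i) - qPow c γ (-dSimple b i)) := by
        rw [hAi, mul_div_cancel₀ _ hε0, Complex.sinh, qPow, qPow, neg_mul_neg, neg_mul, ← hε]
        ring_nf
      have h0 : qPow c γ (dSimple b i) - qPow c γ (-dSimple b i) ≠ 0 := fun h0 => by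
        rw [h0, mul_zero] at e4
        exact mul_ne_zero hε0 (pow_ne_zero 2 (hA i)) e4
      rw [e1, e2, eq_div_iff h0]
      refine mul_left_cancel₀ (mul_ne_zero (mul_ne_zero two_ne_zero hγ0) hc0) ?_
      linear_combination h + ε * ε * A i ^ 2 * P.pb (QE i) (QE (negRoot i)) x * e3 +
        ε * P.pb (QE i) (QE (negRoot i)) x * e4 -
        2 * P.pb (QE i) (QE (negRoot i)) x *
          (qPow c γ (dSimple b i) - qPow c γ (-dSimple b i)) * hε
    · have hij' : (i : H.root) ≠ j := fun h => hij (Subtype.ext h)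
      rw [if_neg hij', if_neg hij'.symm] at h
      simp only [mul_zero, smul_zero, sub_self] at h
      rw [if_neg hij, (mul_eq_zero.mp h).resolve_left (neg_ne_zero.mpr (mul_ne_zero
        (mul_ne_zero (Complex.exp_ne_zero _) (mul_ne_zero hε0 (hA _)))
        (mul_ne_zero (Complex.exp_ne_zero _) (mul_ne_zero hε0 (hA _))))), mul_zero]
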